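/- Let $K$ be a unital commutative $\mathbb{Q}$-algebra, let $z=(z_1,\dots,z_n)$ be either commuting variables or free noncommuting variables, and let $t$ be a formal central parameter. Let $\alpha\ge 1$ and let $F_t$ be an automorphism of the $K[[t]]$-algebra $K[[t]]\langle\langle z\rangle\rangle$ of formal power series in $z$ over $K[[t]]$, of the form $F_t(z)=z-H_t(z)$, where every component of $H_t$ contains only monomials of degree at least $\alpha$ in $z$, and $H_{t=0}(z)=0$. Write $G_t=F_t^{-1}$ and $G_t(z)=z+M_t(z)$, and put $$h(t)=\Big[\tfrac{\partial M_t}{\partial t}(F_t)\,\tfrac{\partial}{\partial z}\Big],$$ the $K[[t]]$-derivation of $K[[t]]\langle\langle z\rangle\rangle$ that maps each $z_i$ to the $i$-th component of $\frac{\partial M_t}{\partial t}(F_t)$; it is regarded as a power series in $t$ whose coefficients are derivations of $K\langle\langle z\rangle\rangle$. Let $\mathcal D^{[\alpha]}\langle\langle z\rangle\rangle$ be the unital algebra of operators on $K\langle\langle z\rangle\rangle$ generated by the $K$-derivations that increase the degree in $z$ by at least $\alpha-1$. Then there is a unique $d(t)\in \mathcal D^{[\alpha]}\langle\langle z\rangle\rangle[[t]]$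 with $d(0)=0$ and $e^{d(t)}u_t(z)=u_t(G_t)$ for all $u_t(z)\in K[[t]]\langle\langle z\rangle\rangle$, and it is given by $$d(t)=\sum_{r\ge 1}\int_0^t dt_1\int_0^{t_1}dt_2\cdots\int_0^{t_{r-1}}dt_r\ \sum_{\sigma\in \mathbf S_r}\frac{(-1)^{d(\sigma)}}{r}\binom{r-1}{d(\sigma)}^{-1}h(t_{\sigma(r)})\cdots h(t_{\sigma(1)}),$$ where $\mathbf S_r$ is the symmetric group of degree $r$ and $d(\sigma)$ is the number of descents of $\sigma$, i.e. of indices $1\le i<r$ with $\sigma(i)>\sigma(i+1)$. Here $t_1,\dots,t_r$ are formal central variables, the integrals are taken formally (monomial by monomial), and each power of $t$ occurs in only finitely many terms of the sum over $r$. -/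

import Mathlib

open scoped PowerSeries
open Finset.HasAntidiagonal (antidiagonal mem_antidiagonal)

noncomputable section

namespace NCSDLog

/-! ### Formal power series in commutative or noncommutative variables -/

/-- Whether the variables `z = (z_1, …, z_n)` commute with each other or are free. -/
inductive VarKind where
  | commuting
  | free

/-- The (additively written) monoid of monomials in `n` variables: exponent vectors for
commuting variables, words for free variables. -/
def Mon : VarKind → ℕ → Type
  | .commuting, n => Fin n →₀ ℕ
  | .free, n => FreeAddMonoid (Fin n)

instance Mon.instAddMonoid : (c : VarKind) → (n : ℕ) → AddMonoid (Mon c n)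
  | .commuting, n => inferInstanceAs (AddMonoid (Fin n →₀ ℕ))
  | .free, n => inferInstanceAs (AddMonoid (FreeAddMonoid (Fin n)))

instance Mon.instDecidableEq (c : VarKind) (n : ℕ) : DecidableEq (Mon c n) :=
  Classical.decEq _

/-- The monomial with a given exponent vector, and its inverse. -/
def Mon.ofExp {n : ℕ} : (Fin n →₀ ℕ) ≃ Mon .commuting n := Equiv.refl _

/-- The monomial given by a word, and its inverse. -/
def Mon.ofWord {n : ℕ} : FreeAddMonoid (Fin n) ≃ Mon .free n := Equiv.refl _

/-- The finite set of all factorizations of a word into a prefix and a suffix. -/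
instance instHasAntidiagonalFree (n : ℕ) : Finset.HasAntidiagonal (FreeAddMonoid (Fin n)) where
  antidiagonal w := open Classical in
    ((Finset.range (w.toList.length + 1)).image fun k =>
      (FreeAddMonoid.ofList (w.toList.take k), FreeAddMonoid.ofList (w.toList.drop k)))
  mem_antidiagonal := by
    rintro w ⟨a, b⟩
    simp only [Finset.mem_image, Finset.mem_range, Prod.mk.injEq]
    constructor
    · rintro ⟨k, -, rfl, rfl⟩
      rw [← FreeAddMonoid.ofList_append, List.take_append_drop]
      rfl
    · rintro rfl
      refine ⟨a.toList.length, ?_, ?_, ?_⟩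
      · simp [FreeAddMonoid.toList_add]
      · simp [FreeAddMonoid.toList_add]
      · simp [FreeAddMonoid.toList_add]

instance Mon.instHasAntidiagonal :
    (c : VarKind) → (n : ℕ) → Finset.HasAntidiagonal (Mon c n)
  | .commuting, n => inferInstanceAs (Finset.HasAntidiagonal (Fin n →₀ ℕ))
  | .free, n => inferInstanceAs (Finset.HasAntidiagonal (FreeAddMonoid (Fin n)))

/-- The monomial `z_i`. -/
def Mon.var : (c : VarKind) → {n : ℕ} → Fin n → Mon c n
  | .commuting, _, i => Mon.ofExp (Finsupp.single i 1)
  | .free, _, i => Mon.ofWord (FreeAddMonoid.of i)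

/-- The degree of a monomial (the length of a word). -/
def Mon.deg : (c : VarKind) → {n : ℕ} → Mon c n → ℕ
  | .commuting, _, w => ∑ i, (Mon.ofExp.symm w) i
  | .free, _, w => (FreeAddMonoid.toList (Mon.ofWord.symm w)).length

/-- `R⟨⟨z⟩⟩`: formal power series in `n` variables over `R`, given by their coefficients. -/
@[ext] structure Series (c : VarKind) (n : ℕ) (R : Type*) where
  /-- The coefficient of a monomial. -/
  coeff : Mon c n → R

namespace Series

variable {c : VarKind} {n : ℕ} {R : Type*}

section Module

variable [AddCommGroup R]

instance : Zero (Series c n R) := ⟨⟨0⟩⟩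
instance : Add (Series c n R) := ⟨fun f g => ⟨f.coeff + g.coeff⟩⟩
instance : Neg (Series c n R) := ⟨fun f => ⟨-f.coeff⟩⟩
instance : Sub (Series c n R) := ⟨fun f g => ⟨f.coeff - g.coeff⟩⟩
instance {S : Type*} [Semiring S] [Module S R] : SMul S (Series c n R) :=
  ⟨fun s f => ⟨s • f.coeff⟩⟩

@[simp] theorem coeff_zero (w : Mon c n) : (0 : Series c n R).coeff w = 0 := rfl
@[simp] theorem coeff_add (f g : Series c n R) (w : Mon c n) :
    (f + g).coeff w = f.coeff w + g.coeff w := rfl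
@[simp] theorem coeff_neg (f : Series c n R) (w : Mon c n) : (-f).coeff w = -f.coeff w := rfl
@[simp] theorem coeff_sub (f g : Series c n R) (w : Mon c n) :
    (f - g).coeff w = f.coeff w - g.coeff w := rfl
@[simp] theorem coeff_smul {S : Type*} [Semiring S] [Module S R] (s : S) (f : Series c n R)
    (w : Mon c n) : (s • f).coeff w = s • f.coeff w := rfl

instance : AddCommGroup (Series c n R) :=
  Function.Injective.addCommGroup coeff (fun _ _ h => Series.ext h) rfl (fun _ _ => rfl)
    (fun _ => rfl) (fun _ _ => rfl) (fun _ _ => rfl) (fun _ _ => rfl)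

instance {S : Type*} [Semiring S] [Module S R] : Module S (Series c n R) where
  one_smul f := by ext w; simp
  mul_smul r s f := by ext w; simp [mul_smul]
  smul_zero r := by ext w; simp
  smul_add r f g := by ext w; simp
  add_smul r s f := by ext w; simp [add_smul]
  zero_smul f := by ext w; simp

end Module

section Ring

variable [CommRing R]

instance : One (Series c n R) := ⟨⟨fun w => if w = 0 then 1 else 0⟩⟩

/-- The Cauchy product. -/
instance : Mul (Series c n R) :=
  ⟨fun f g => ⟨fun w => ∑ p ∈ antidiagonal w, f.coeff p.1 * g.coeff p.2⟩⟩

theorem coeff_one (w : Mon c n) : (1 : Series c n R).coeff w = if w = 0 then 1 else 0 := rfl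

theorem coeff_mul (f g : Series c n R) (w : Mon c n) :
    (f * g).coeff w = ∑ p ∈ antidiagonal w, f.coeff p.1 * g.coeff p.2 := rfl

instance instRing : Ring (Series c n R) where
  __ := (inferInstance : AddCommGroup (Series c n R))
  left_distrib f g h := by
    ext w
    simp only [coeff_mul, coeff_add, mul_add, Finset.sum_add_distrib]
  right_distrib f g h := by
    ext w
    simp only [coeff_mul, coeff_add, add_mul, Finset.sum_add_distrib]
  zero_mul f := by
    ext w
    exact Finset.sum_eq_zero fun p _ => zero_mul _
  mul_zero f := by
    ext w
    exact Finset.sum_eq_zero fun p _ => mul_zero _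
  one_mul f := by
    ext w
    rw [coeff_mul, Finset.sum_eq_single (0, w)]
    · simp [coeff_one]
    · rintro ⟨a, b⟩ hab hne
      rw [mem_antidiagonal] at hab
      have : a ≠ 0 := by
        rintro rfl
        simp only [zero_add] at hab
        exact hne (by rw [hab])
      simp [coeff_one, this]
    · intro h
      simp at h
  mul_one f := by
    ext w
    rw [coeff_mul, Finset.sum_eq_single (w, 0)]
    · simp [coeff_one]
    · rintro ⟨a, b⟩ hab hne
      rw [mem_antidiagonal] at hab
      have : b ≠ 0 := by
        rintro rfl
        simp only [add_zero] at hab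
        exact hne (by rw [hab])
      simp [coeff_one, this]
    · intro h
      simp at h
  mul_assoc f g h := by
    ext w
    simp only [coeff_mul, Finset.sum_mul, Finset.mul_sum]
    rw [Finset.sum_sigma', Finset.sum_sigma']
    refine Finset.sum_bij' (fun x _ => ⟨(x.2.1, x.2.2 + x.1.2), (x.2.2, x.1.2)⟩)
      (fun x _ => ⟨(x.1.1 + x.2.1, x.2.2), (x.1.1, x.2.1)⟩) ?_ ?_ ?_ ?_ ?_
    · rintro ⟨⟨a, b⟩, ⟨a', b'⟩⟩ hx
      simp only [Finset.mem_sigma, mem_antidiagonal] at hx ⊢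
      exact ⟨by rw [← add_assoc, hx.2, hx.1], trivial⟩
    · rintro ⟨⟨a, b⟩, ⟨a', b'⟩⟩ hx
      simp only [Finset.mem_sigma, mem_antidiagonal] at hx ⊢
      exact ⟨by rw [add_assoc, hx.2, hx.1], trivial⟩
    · rintro ⟨⟨a, b⟩, ⟨a', b'⟩⟩ hx
      simp only [Finset.mem_sigma, mem_antidiagonal] at hx
      obtain ⟨-, rfl⟩ := hx
      rfl
    · rintro ⟨⟨a, b⟩, ⟨a', b'⟩⟩ hx
      simp only [Finset.mem_sigma, mem_antidiagonal] at hx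
      obtain ⟨-, rfl⟩ := hx
      rfl
    · rintro ⟨⟨a, b⟩, ⟨a', b'⟩⟩ _
      exact mul_assoc _ _ _

instance instAlgebra : Algebra R (Series c n R) :=
  Algebra.ofModule
    (fun r f g => by
      ext w
      simp only [coeff_mul, coeff_smul, smul_eq_mul, Finset.mul_sum, mul_assoc])
    (fun r f g => by
      ext w
      simp only [coeff_mul, coeff_smul, smul_eq_mul, Finset.mul_sum, mul_left_comm])

/-- The variable `z_i` as a formal power series. -/
def X (i : Fin n) : Series c n R := ⟨fun w => if w = Mon.var c i then 1 else 0⟩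

/-- For commuting variables, `Series` is Mathlib's ring of multivariate power series. -/
def equivMvPowerSeries : Series .commuting n R ≃+* MvPowerSeries (Fin n) R where
  toFun f := fun e => f.coeff (Mon.ofExp e)
  invFun f := ⟨fun w => MvPowerSeries.coeff (Mon.ofExp.symm w) f⟩
  left_inv _ := rfl
  right_inv _ := rfl
  map_add' _ _ := rfl
  map_mul' f g := by
    classical
    refine MvPowerSeries.ext fun e => ?_
    refine Eq.trans ?_ (MvPowerSeries.coeff_mul e _ _).symm
    refine Finset.sum_congr ?_ fun _ _ => rfl
    exact congrArg (fun A : Finset.HasAntidiagonal (Fin n →₀ ℕ) => A.antidiagonal e)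
      (Subsingleton.elim _ _)

end Ring

/-- `o(f) ≥ k`: the series `f` has no monomial of degree less than `k`. -/
def OrderGE [Zero R] (k : ℕ) (f : Series c n R) : Prop :=
  ∀ w : Mon c n, Mon.deg c w < k → f.coeff w = 0

end Series

/-! ### Derivations and differential operators -/

section Operators

variable {c : VarKind} {n : ℕ} {K : Type*} [CommRing K]

/-- A `K`-linear endomorphism of `K⟨⟨z⟩⟩` satisfying the Leibniz rule. -/
def IsDerivation (δ : Module.End K (Series c n K)) : Prop :=
  ∀ f g : Series c n K, δ (f * g) = δ f * g + f * δ g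

/-- The operator `δ` increases the degree in `z` by at least `α - 1` (for `α ≥ 1`). -/
def RaisesDegree (α : ℕ) (δ : Module.End K (Series c n K)) : Prop :=
  ∀ (k : ℕ) (f : Series c n K), f.OrderGE k → (δ f).OrderGE (k + (α - 1))

/-- `𝒟^{[α]}⟨⟨z⟩⟩`: the unital algebra of differential operators generated by the
`K`-derivations of `K⟨⟨z⟩⟩` which increase the degree by at least `α - 1`. -/
def diffOps (c : VarKind) (n : ℕ) (K : Type*) [CommRing K] (α : ℕ) :
    Subalgebra K (Module.End K (Series c n K)) :=
  Algebra.adjoin K {δ | IsDerivation δ ∧ RaisesDegree α δ}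

/-- `[u ∂/∂z]`, the `K`-derivation with `z_i ↦ u_i`. For commuting variables it is
`∑ i, u_i ∂/∂z_i`; for free variables it replaces, in every word, each single occurrence of
`z_i` in turn by `u_i`. -/
def bracketDer : (c : VarKind) → {n : ℕ} → {K : Type*} → [CommRing K] →
    (Fin n → Series c n K) → Module.End K (Series c n K)
  | .commuting, n, K, _, u =>
    { toFun := fun f => ∑ i : Fin n, u i * (⟨fun w =>
        ((Mon.ofExp.symm w i + 1 : ℕ) : K) *
          f.coeff (Mon.ofExp (Mon.ofExp.symm w + Finsupp.single i 1))⟩ : Series .commuting n K)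
      map_add' := fun f g => by
        rw [← Finset.sum_add_distrib]
        refine Finset.sum_congr rfl fun i _ => ?_
        rw [← mul_add]
        congr 1
        ext w
        simp [mul_add]
      map_smul' := fun r f => by
        rw [Finset.smul_sum]
        refine Finset.sum_congr rfl fun i _ => ?_
        rw [← mul_smul_comm]
        congr 1
        ext w
        simp [mul_left_comm] }
  | .free, n, K, _, u =>
    { toFun := fun f => ⟨fun w => ∑ i : Fin n, ∑ p ∈ antidiagonal w, ∑ q ∈ antidiagonal p.2,
        f.coeff (p.1 + Mon.var .free i + q.2) * (u i).coeff q.1⟩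
      map_add' := fun f g => by
        ext w
        simp only [Series.coeff_add, add_mul, Finset.sum_add_distrib]
      map_smul' := fun r f => by
        ext w
        simp only [Series.coeff_smul, smul_eq_mul, mul_assoc, Finset.mul_sum, RingHom.id_apply] }

end Operators

/-! ### The parameter `t` -/

section Parameter

variable {c : VarKind} {n : ℕ} {K : Type*} [CommRing K]

/-- The coefficient of `t^m` of an element of `K[[t]]⟨⟨z⟩⟩`, an element of `K⟨⟨z⟩⟩`. -/
def tCoeff (m : ℕ) (u : Series c n K⟦X⟧) : Series c n K :=
  ⟨fun w => PowerSeries.coeff m (u.coeff w)⟩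

/-- The coefficientwise derivative `∂/∂t` of `K[[t]]⟨⟨z⟩⟩`. -/
def tDeriv (u : Series c n K⟦X⟧) : Series c n K⟦X⟧ :=
  ⟨fun w => PowerSeries.derivative K (u.coeff w)⟩

/-- The action of `∑ t^i P_i`, with `P_i` operators on `K⟨⟨z⟩⟩`, on `K[[t]]⟨⟨z⟩⟩`:
`∑ t^j u_j ↦ ∑ t^(i+j) P_i u_j`. -/
def act (P : (Module.End K (Series c n K))⟦X⟧) (u : Series c n K⟦X⟧) : Series c n K⟦X⟧ :=
  ⟨fun w => PowerSeries.mk fun m =>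
    ∑ p ∈ antidiagonal m, ((PowerSeries.coeff p.1 P) (tCoeff p.2 u)).coeff w⟩

/-- `F_t ∈ 𝔸_t^{[α]}⟨⟨z⟩⟩`: the automorphism `F_t` of `K[[t]]⟨⟨z⟩⟩` over `K[[t]]` has the form
`F_t(z) = z - H_t(z)` with `o(H_t(z)) ≥ α` and `H_{t=0}(z) = 0`.
The automorphism acts by `u ↦ u(F_t)`, so that `F_t(z_i) = F (z_i)`. -/
def InAut (α : ℕ) (F : Series c n K⟦X⟧ ≃ₐ[K⟦X⟧] Series c n K⟦X⟧) : Prop :=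
  ∀ i : Fin n, (Series.X i - F (Series.X i)).OrderGE α ∧
    tCoeff 0 (Series.X i - F (Series.X i)) = 0

/-- `M_t(z) = G_t(z) - z`, where `G_t` is the inverse of `F_t`. -/
def inverseDisplacement (F : Series c n K⟦X⟧ ≃ₐ[K⟦X⟧] Series c n K⟦X⟧) (i : Fin n) :
    Series c n K⟦X⟧ :=
  F.symm (Series.X i) - Series.X i

/-- `h(t) = [∂M_t/∂t (F_t) ∂/∂z]`, expanded as a power series in `t` whose coefficients are
derivations of `K⟨⟨z⟩⟩`: `[(∑ t^m u_m) ∂/∂z] = ∑ t^m [u_m ∂/∂z]`. -/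
def hSeries (F : Series c n K⟦X⟧ ≃ₐ[K⟦X⟧] Series c n K⟦X⟧) :
    (Module.End K (Series c n K))⟦X⟧ :=
  PowerSeries.mk fun m =>
    bracketDer c fun i => tCoeff m (F (tDeriv (inverseDisplacement F i)))

end Parameter

/-! ### Formal series of power series, exponentials -/

/-- `∑ r, T r = S` formally: every power of `t` occurs in only finitely many of the `T r`, and
`S` is the coefficientwise sum. -/
def FormalHasSum {R : Type*} [Ring R] (T : ℕ → R⟦X⟧) (S : R⟦X⟧) : Prop :=
  ∀ m : ℕ, (Function.support fun r => PowerSeries.coeff m (T r)).Finite ∧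
    PowerSeries.coeff m S = ∑ᶠ r, PowerSeries.coeff m (T r)

section Algebraic

variable (K : Type*) [CommRing K] [Algebra ℚ K] {R : Type*} [Ring R] [Algebra K R]

/-- `E = e^d = ∑ m, d^m / m!`. -/
def IsExp (d E : R⟦X⟧) : Prop :=
  FormalHasSum (fun m => algebraMap ℚ K (1 / (m.factorial : ℚ)) • d ^ m) E

/-! ### Iterated integrals of formal power series over simplices

A formal power series in central variables `t_0, …, t_r` with coefficients in `R` is an element of
`MvPowerSeries (Fin (r + 1)) R`; the variable `t_0` plays the role of `t`. -/

/-- The series `p(t_i)`. -/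
def inVar {σ : Type*} (i : σ) (p : R⟦X⟧) : MvPowerSeries σ R := fun e =>
  open Classical in if e = Finsupp.single i (e i) then PowerSeries.coeff (e i) p else 0

/-- The antiderivative with respect to `t_i` which vanishes at `t_i = 0`. -/
def antideriv {σ : Type*} (i : σ) (f : MvPowerSeries σ R) : MvPowerSeries σ R := fun e =>
  if e i = 0 then 0
  else algebraMap ℚ K (1 / (e i : ℚ)) • MvPowerSeries.coeff (e - Finsupp.single i 1) f

/-- The substitution `t_{r+1} := t_r` of the last variable. -/
def substLast {r : ℕ} (f : MvPowerSeries (Fin (r + 2)) R) : MvPowerSeries (Fin (r + 1)) R :=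
  fun e => ∑ p ∈ antidiagonal (e (Fin.last r)),
    MvPowerSeries.coeff (Finsupp.equivFunOnFinite.symm
      (Fin.snoc (Function.update (e : Fin (r + 1) → ℕ) (Fin.last r) p.1) p.2)) f

/-- `∫_0^t dt_1 ∫_0^{t_1} dt_2 ⋯ ∫_0^{t_{r-1}} dt_r f(t, t_1, …, t_r)`, as a series in `t = t_0`.
The innermost integral is performed first. -/
def simplexIntegral : (r : ℕ) → MvPowerSeries (Fin (r + 1)) R → R⟦X⟧
  | 0, f => PowerSeries.mk fun m => MvPowerSeries.coeff (Finsupp.single 0 m) f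
  | r + 1, f => simplexIntegral r (substLast (antideriv K (Fin.last (r + 1)) f))

/-- The number of descents of a permutation: positions `i` with `σ(i) > σ(i+1)`. -/
def numDescents {r : ℕ} (s : Equiv.Perm (Fin r)) : ℕ :=
  Nat.card {i : Fin r // ∃ hi : (i : ℕ) + 1 < r, s ⟨i + 1, hi⟩ < s i}

/-- `(-1)^{d(σ)} / r * binom(r-1, d(σ))⁻¹` for `σ ∈ S_r`. -/
def descentWeight {r : ℕ} (s : Equiv.Perm (Fin r)) : ℚ :=
  (-1) ^ numDescents s / r * ((r - 1).choose (numDescents s) : ℚ)⁻¹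

/-- `h(t_{σ(r)}) ⋯ h(t_{σ(1)})` as a series in `t = t_0, t_1, …, t_r`; the index `j : Fin r`
stands for the variable `t_{j+1}`, that is, for `j.succ : Fin (r + 1)`. -/
def orderedProduct {r : ℕ} (h : R⟦X⟧) (s : Equiv.Perm (Fin r)) : MvPowerSeries (Fin (r + 1)) R :=
  (List.ofFn fun j : Fin r => inVar (s j.rev).succ h).prod

/-- The degree `r` term of the continuous Baker–Campbell–Hausdorff series of `h`. -/
def bchTerm (h : R⟦X⟧) (r : ℕ) : R⟦X⟧ :=
  simplexIntegral K r
    (∑ s : Equiv.Perm (Fin r), algebraMap ℚ K (descentWeight s) • orderedProduct h s)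

end Algebraic

/-- `d(t)` is an element of `𝒟^{[α]}⟨⟨z⟩⟩[[t]]` with `d(0) = 0` and `e^{d(t)} u_t(z) = u_t(G_t)` for
all `u_t(z) ∈ K[[t]]⟨⟨z⟩⟩`, where `G_t` is the inverse of `F_t`. -/
def IsDLog {c : VarKind} {n : ℕ} {K : Type*} [CommRing K] [Algebra ℚ K] (α : ℕ)
    (F : Series c n K⟦X⟧ ≃ₐ[K⟦X⟧] Series c n K⟦X⟧) (d : (Module.End K (Series c n K))⟦X⟧) : Prop :=
  (∀ m, PowerSeries.coeff m d ∈ diffOps c n K α) ∧ PowerSeries.coeff 0 d = 0 ∧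
    ∃ E, IsExp K d E ∧ ∀ u : Series c n K⟦X⟧, act E u = F.symm u

end NCSDLog

end

/-! Let E(t) be the operator series u ↦ u(G_t). The chain rule gives E' = E h with E(0) = 1
(`tDeriv_symm`, `euler_expansion`), so d has to be the logarithm of the solution of a linear
equation in a noncommutative algebra. What remains is the continuous Baker–Campbell–Hausdorff
formula `exists_isExp_bchTerm`, where the variables z no longer matter.

The logarithm is obtained from log E = ∫_0^1 P_x dx with P_x = (E - 1)(1 + x(E - 1))⁻¹. With θ = t
d/dt, the series P = P_x solves the Riccati equation θP = (1 + (1 - x)P) · t h · (1 - xP). Expand P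
in words γ_{b_1} ⋯ γ_{b_r}, where γ_b is the coefficient of t^b in t h. The equation becomes a
recursion: the coefficient of a word, times the sum of its letters, is a sum over a distinguished
letter of the coefficients of the prefix and the suffix, with a factor 1 - x for a nonempty prefix
and -x for a nonempty suffix (`C_sum_mul_wordPoly`).

The recursion is solved by a sum over all orders of removing the letters one by one. The first
removal cuts the word into two pieces that no longer interact, and the interleavings of their orders
add up to a product (`elimSum_union`). For the order belonging to a permutation σ, the reciprocal
running sums are the simplex integral of a monomial, and the neighbour factors multiply to (1 -
x)^(ascents) (-x)^(descents) (`wordPoly_ofFn`). Integrating over x is a Beta integral and yields the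
weight (-1)^d(σ) / r · binom(r-1, d(σ))⁻¹. The series built from words is identified with P_x by
uniqueness for a linear equation (`riccati_mul`).

Uniqueness of d: the action on series free of t determines E, and E determines its logarithm without
constant term. -/

noncomputable section

namespace NCSDLog

/-! ### Sums over elimination orders -/

section Elimination

open Polynomial

variable {ι : Type*} [DecidableEq ι]

/-- The sum over all orders in which the elements of `A` can be removed one by one: removing `j`
and leaving `B` contributes the factor `κ j B`, divided by the sum of `b` before the removal. -/
def elimSum (b : ι → ℚ) (κ : ι → Finset ι → ℚ[X]) (A : Finset ι) : ℚ[X] :=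
  if A = ∅ then 1
  else C (∑ i ∈ A, b i)⁻¹ * ∑ j : A, κ j (A.erase j) * elimSum b κ (A.erase j)
termination_by A.card
decreasing_by exact Finset.card_erase_lt_of_mem j.2

variable (b : ι → ℚ) (κ : ι → Finset ι → ℚ[X])

theorem elimSum_empty : elimSum b κ ∅ = 1 := by
  rw [elimSum, if_pos rfl]

theorem elimSum_of_ne_empty {A : Finset ι} (hA : A ≠ ∅) : elimSum b κ A =
    C (∑ i ∈ A, b i)⁻¹ * ∑ j ∈ A, κ j (A.erase j) * elimSum b κ (A.erase j) := by
  rw [elimSum, if_neg hA]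
  congr 1
  exact Finset.sum_coe_sort A fun j => κ j (A.erase j) * elimSum b κ (A.erase j)

/-- Clearing the denominator gives a form that also covers the empty set, where both sides vanish;
positivity only serves to make the denominator nonzero. -/
theorem C_sum_mul_elimSum {A : Finset ι} (hb : ∀ i ∈ A, 0 < b i) :
    C (∑ i ∈ A, b i) * elimSum b κ A =
      ∑ j ∈ A, κ j (A.erase j) * elimSum b κ (A.erase j) := by
  rcases eq_or_ne A ∅ with rfl | hA
  · simp
  · have : ∑ i ∈ A, b i ≠ 0 :=
      (Finset.sum_pos hb (Finset.nonempty_iff_ne_empty.2 hA)).ne'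
    rw [elimSum_of_ne_empty b κ hA, ← mul_assoc, ← C_mul, mul_inv_cancel₀ this, C_1, one_mul]

/-- Relabelling invariance. It shifts a suffix of a word back to position 0 and passes from `Fin r`
to positions in `ℕ`. -/
theorem elimSum_map {ι' : Type*} [DecidableEq ι'] (e : ι ↪ ι') (b' : ι' → ℚ)
    (κ' : ι' → Finset ι' → ℚ[X]) (A : Finset ι) (hb : ∀ i ∈ A, b i = b' (e i))
    (hκ : ∀ j ∈ A, ∀ B ⊆ A, κ j B = κ' (e j) (B.map e)) :
    elimSum b κ A = elimSum b' κ' (A.map e) := by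
  induction A using Finset.strongInduction with
  | H A ih =>
    rcases eq_or_ne A ∅ with rfl | hA
    · simp [elimSum_empty]
    · rw [elimSum_of_ne_empty b κ hA, elimSum_of_ne_empty b' κ' (by simpa using hA),
        Finset.sum_map, Finset.sum_map, Finset.sum_congr rfl hb]
      congr 1
      refine Finset.sum_congr rfl fun j hj => ?_
      rw [← Finset.map_erase, ← hκ j hj _ (Finset.erase_subset _ _),
        ih _ (Finset.erase_ssubset hj) (fun i hi => hb i (Finset.mem_of_mem_erase hi))
          fun i hi B hB => hκ i (Finset.mem_of_mem_erase hi) B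
            (hB.trans (Finset.erase_subset _ _))]

/-- Shuffle identity, the discrete form of writing a product of two simplex integrals as a sum over
interleavings. After multiplication by the total sum b(A) + b(B), the first removed element lies in
A or in B, and induction on the number of elements applies to what is left. The two hypotheses on
`κ` say that removals in one block do not see the other. -/
theorem elimSum_union (n : ℕ) : ∀ A B : Finset ι, A.card + B.card = n → Disjoint A B →
    (∀ i ∈ A ∪ B, 0 < b i) →
    (∀ j ∈ A, ∀ A' ⊆ A, ∀ B' ⊆ B, κ j (A' ∪ B') = κ j A') →
    (∀ j ∈ B, ∀ A' ⊆ A, ∀ B' ⊆ B, κ j (A' ∪ B') = κ j B') →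
    elimSum b κ (A ∪ B) = elimSum b κ A * elimSum b κ B := by
  induction n with
  | zero =>
    intro A B h
    obtain ⟨rfl, rfl⟩ : A = ∅ ∧ B = ∅ := by simpa using h
    simp [elimSum_empty]
  | succ n ih =>
    intro A B h hd hb hA hB
    have hN : ∑ i ∈ A ∪ B, b i ≠ 0 := by
      refine (Finset.sum_pos hb (Finset.card_pos.1 ?_)).ne'
      rw [Finset.card_union_of_disjoint hd]
      omega
    refine mul_left_cancel₀ (C_ne_zero.2 hN) ?_
    rw [C_sum_mul_elimSum b κ hb, Finset.sum_union hd, Finset.sum_union hd, C_add, add_mul,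
      ← mul_assoc, C_sum_mul_elimSum b κ fun i hi => hb i (Finset.mem_union_left _ hi),
      mul_left_comm, C_sum_mul_elimSum b κ fun i hi => hb i (Finset.mem_union_right _ hi),
      Finset.sum_mul, Finset.mul_sum]
    congr 1
    · refine Finset.sum_congr rfl fun j hj => ?_
      have hj' : j ∉ B := Finset.disjoint_left.1 hd hj
      have hs := Finset.erase_subset j A
      rw [Finset.erase_union_distrib, Finset.erase_eq_of_notMem hj',
        hA j hj _ hs _ subset_rfl, ih (A.erase j) B, mul_assoc]
      · rw [Finset.card_erase_of_mem hj]
        have := Finset.card_pos.2 ⟨j, hj⟩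
        omega
      · exact hd.mono_left hs
      · exact fun i hi => hb i (Finset.union_subset_union_left hs hi)
      · exact fun i hi A' h1 => hA i (hs hi) A' (h1.trans hs)
      · exact fun i hi A' h1 => hB i hi A' (h1.trans hs)
    · refine Finset.sum_congr rfl fun j hj => ?_
      have hj' : j ∉ A := Finset.disjoint_right.1 hd hj
      have hs := Finset.erase_subset j B
      rw [Finset.erase_union_distrib, Finset.erase_eq_of_notMem hj',
        hB j hj _ subset_rfl _ hs, ih A (B.erase j), mul_left_comm]
      · rw [Finset.card_erase_of_mem hj]
        have := Finset.card_pos.2 ⟨j, hj⟩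
        omega
      · exact hd.mono_right hs
      · exact fun i hi => hb i (Finset.union_subset_union_right hs hi)
      · exact fun i hi A' h1 B' h2 => hA i hi A' h1 B' (h2.trans hs)
      · exact fun i hi A' h1 B' h2 => hB i (hs hi) A' h1 B' (h2.trans hs)

/-- The contribution to `elimSum` of the order `f 0, f 1, …` of removal. -/
def orderWeight {k : ℕ} (f : Fin k → ι) : ℚ[X] :=
  ∏ i, C (∑ i' ∈ Finset.Ici i, b (f i'))⁻¹ * κ (f i) ((Finset.Ioi i).image f)

theorem orderWeight_cons {k : ℕ} (j : ι) (g : Fin k → ι) :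
    orderWeight b κ (Fin.cons j g : Fin (k + 1) → ι) =
      C (b j + ∑ i, b (g i))⁻¹ * κ j (Finset.univ.image g) * orderWeight b κ g := by
  have h0 : (Finset.Ici (0 : Fin (k + 1))) = Finset.univ := by ext; simp
  have h1 : ((Finset.Ioi (0 : Fin (k + 1))).image (Fin.cons j g : Fin (k + 1) → ι)) =
      Finset.univ.image g := by
    have : Finset.Ioi (0 : Fin (k + 1)) = Finset.univ.map (Fin.succEmb k) := by
      ext x
      refine Fin.cases ?_ (fun x => ?_) x <;> simp
    rw [this, Finset.map_eq_image, Finset.image_image]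
    rfl
  rw [orderWeight, Fin.prod_univ_succ, h0, h1, Fin.sum_univ_succ]
  simp only [Fin.cons_zero, Fin.cons_succ]
  congr 1
  refine Finset.prod_congr rfl fun i _ => ?_
  have h2 : Finset.Ici i.succ = (Finset.Ici i).map (Fin.succEmb k) := by
    ext x
    refine Fin.cases ?_ (fun x => ?_) x <;> simp
  have h3 : (Finset.Ioi i.succ) = (Finset.Ioi i).map (Fin.succEmb k) := by
    ext x
    refine Fin.cases ?_ (fun x => ?_) x <;> simp
  rw [h2, h3, Finset.sum_map, Finset.map_eq_image, Finset.image_image]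
  rfl

/-- Unrolling the recursion: an order of removal is an injective enumeration, and its head is the
first element removed. -/
theorem elimSum_eq_sum_orderWeight [Fintype ι] (k : ℕ) : ∀ A : Finset ι, A.card = k →
    elimSum b κ A = ∑ f : Fin k → ι with Function.Injective f ∧ ∀ i, f i ∈ A,
      orderWeight b κ f := by
  induction k with
  | zero =>
    intro A hA
    obtain rfl := Finset.card_eq_zero.1 hA
    rw [elimSum_empty, Finset.filter_true_of_mem]
    · simp [orderWeight]
    · intro f _
      exact ⟨Function.injective_of_subsingleton f, fun i => i.elim0⟩
  | succ k ih =>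
    intro A hA
    have hne : A ≠ ∅ := by
      rintro rfl
      simp at hA
    rw [elimSum_of_ne_empty b κ hne, Finset.sum_filter,
      ← (Fin.consEquiv fun _ : Fin (k + 1) => ι).sum_comp, Fintype.sum_prod_type,
      Finset.mul_sum, ← Finset.sum_subset (Finset.subset_univ A)]
    · refine Finset.sum_congr rfl fun j hj => ?_
      have hc : (A.erase j).card = k := by
        rw [Finset.card_erase_of_mem hj, hA, Nat.add_sub_cancel]
      rw [ih _ hc, Finset.sum_filter, Finset.mul_sum, Finset.mul_sum]
      refine Finset.sum_congr rfl fun g _ => ?_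
      have hiff : (Function.Injective ((Fin.consEquiv fun _ : Fin (k + 1) => ι) (j, g)) ∧
          ∀ i, (Fin.consEquiv fun _ : Fin (k + 1) => ι) (j, g) i ∈ A) ↔
          Function.Injective g ∧ ∀ i, g i ∈ A.erase j := by
        change (Function.Injective (Fin.cons j g : Fin (k + 1) → ι) ∧
          ∀ i, (Fin.cons j g : Fin (k + 1) → ι) i ∈ A) ↔ _
        rw [Fin.cons_injective_iff, Fin.forall_fin_succ]
        simp only [Fin.cons_zero, Fin.cons_succ, Set.mem_range, not_exists, Finset.mem_erase,
          forall_and, hj, true_and]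
        tauto
      by_cases hg : Function.Injective g ∧ ∀ i, g i ∈ A.erase j
      · rw [if_pos (hiff.2 hg), if_pos hg]
        change _ = orderWeight b κ (Fin.cons j g : Fin (k + 1) → ι)
        have him : Finset.univ.image g = A.erase j := by
          refine Finset.eq_of_subset_of_card_le ?_ ?_
          · intro x hx
            obtain ⟨i, -, rfl⟩ := Finset.mem_image.1 hx
            exact hg.2 i
          · rw [Finset.card_image_of_injective _ hg.1, hc]
            simp
        rw [orderWeight_cons, him, ← Finset.add_sum_erase A b hj, ← him,
          Finset.sum_image hg.1.injOn]
        ring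
      · rw [if_neg (mt hiff.1 hg), if_neg hg]
        simp
    · intro j _ hj
      refine Finset.sum_eq_zero fun g _ => if_neg ?_
      exact fun h => hj (h.2 0)

theorem elimSum_univ_eq_sum_perm {r : ℕ} (b : Fin r → ℚ) (κ : Fin r → Finset (Fin r) → ℚ[X]) :
    elimSum b κ Finset.univ = ∑ s : Equiv.Perm (Fin r), orderWeight b κ s := by
  rw [elimSum_eq_sum_orderWeight b κ r _ (Finset.card_fin r)]
  refine (Finset.sum_bij (fun (s : Equiv.Perm (Fin r)) _ => (s : Fin r → Fin r)) ?_ ?_ ?_ ?_).symm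
  · intro s _
    simp [s.injective]
  · intro s _ s' _ h
    exact Equiv.coe_fn_injective h
  · intro f hf
    simp only [Finset.mem_filter, Finset.mem_univ, true_and] at hf
    exact ⟨Equiv.ofBijective f (Finite.injective_iff_bijective.1 hf.1), Finset.mem_univ _, rfl⟩
  · intro s _
    rfl

end Elimination

/-! ### The coefficient of a word -/

section WordPoly

open Polynomial

/-- Removing position `j` from a word contributes `1 - X` if the left neighbour is still present
and `-X` if the right neighbour is still present. -/
def neighborFactor (j : ℕ) (B : Finset ℕ) : ℚ[X] :=
  (if ∃ i ∈ B, i + 1 = j then 1 - X else 1) * (if ∃ i ∈ B, i = j + 1 then -X else 1)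

/-- The coefficient of a word in the solution of the Riccati equation. -/
def wordPoly (l : List ℕ) : ℚ[X] :=
  elimSum (fun i => (l.getD i 0 : ℚ)) neighborFactor (Finset.range l.length)

/-- The word coefficients of 1 + (1 - x)P, the left factor of the Riccati equation. -/
def leftPoly (l : List ℕ) : ℚ[X] := if l = [] then 1 else (1 - X) * wordPoly l

/-- The word coefficients of 1 - xP, the right factor of the Riccati equation. -/
def rightPoly (l : List ℕ) : ℚ[X] := if l = [] then 1 else -X * wordPoly l

theorem wordPoly_nil : wordPoly [] = 1 := by
  simp [wordPoly, elimSum_empty]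

theorem sum_range_getD (l : List ℕ) :
    ∑ i ∈ Finset.range l.length, (l.getD i 0 : ℚ) = (l.sum : ℚ) := by
  induction l with
  | nil => simp
  | cons a l ih =>
    rw [List.length_cons, Finset.sum_range_succ', List.sum_cons, Nat.cast_add, add_comm]
    simp only [List.getD_cons_zero, List.getD_cons_succ, ih]

theorem elimSum_range_eq_wordPoly_take (l : List ℕ) {j : ℕ} (hj : j ≤ l.length) :
    elimSum (fun i => (l.getD i 0 : ℚ)) neighborFactor (Finset.range j) =
      wordPoly (l.take j) := by
  rw [wordPoly, List.length_take, min_eq_left hj]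
  have := elimSum_map (fun i => (l.getD i 0 : ℚ)) neighborFactor (Function.Embedding.refl ℕ)
    (fun i => ((l.take j).getD i 0 : ℚ)) neighborFactor (Finset.range j)
    (fun i hi => by
      rw [Finset.mem_range] at hi
      simp [List.getD_eq_getElem?_getD, hi])
    (fun i _ B _ => by simp)
  simpa using this

/-- Adjacency of positions is invariant under translation, so the suffix may be moved to the origin.
-/
theorem elimSum_Ico_eq_wordPoly_drop (l : List ℕ) (j : ℕ) :
    elimSum (fun i => (l.getD i 0 : ℚ)) neighborFactor (Finset.Ico j l.length) =
      wordPoly (l.drop j) := by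
  have hm : (Finset.range (l.drop j).length).map (addRightEmbedding j) =
      Finset.Ico j l.length := by
    rw [Finset.range_eq_Ico, Finset.map_add_right_Ico, List.length_drop, zero_add]
    rcases le_total j l.length with h | h
    · rw [Nat.sub_add_cancel h]
    · rw [Finset.Ico_eq_empty_of_le h, Finset.Ico_eq_empty_of_le (by omega)]
  rw [wordPoly, ← hm]
  refine (elimSum_map _ _ (addRightEmbedding j) _ _ _ ?_ ?_).symm
  · intro i _
    simp [List.getD_eq_getElem?_getD, add_comm]
  · intro i _ B _
    simp only [neighborFactor, Finset.mem_map, addRightEmbedding_apply]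
    congr 1
    · refine if_congr ⟨?_, ?_⟩ rfl rfl
      · rintro ⟨a, ha, rfl⟩
        exact ⟨a + j, Finset.mem_map.2 ⟨a, ha, rfl⟩, by simp; omega⟩
      · rintro ⟨_, hm, h⟩
        obtain ⟨a, ha, rfl⟩ := Finset.mem_map.1 hm
        exact ⟨a, ha, by simp at h; omega⟩
    · refine if_congr ⟨?_, ?_⟩ rfl rfl
      · rintro ⟨a, ha, rfl⟩
        exact ⟨_, Finset.mem_map.2 ⟨i + 1, ha, rfl⟩, by simp; omega⟩
      · rintro ⟨_, hm, h⟩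
        obtain ⟨a, ha, rfl⟩ := Finset.mem_map.1 hm
        exact ⟨a, ha, by simp at h; omega⟩

/-- The gap at position j separates the two sides: no position below j is adjacent to one above it.
This is the independence required by `elimSum_union`. -/
theorem neighborFactor_union_left {j r i : ℕ} (hi : i < j) {A B : Finset ℕ}
    (hB : B ⊆ Finset.Ico (j + 1) r) : neighborFactor i (A ∪ B) = neighborFactor i A := by
  have h : ∀ x ∈ B, j + 1 ≤ x := fun x hx => (Finset.mem_Ico.1 (hB hx)).1
  rw [neighborFactor, neighborFactor]
  congr 1 <;> refine if_congr ⟨?_, ?_⟩ rfl rfl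
  · rintro ⟨a, ha, h'⟩
    rcases Finset.mem_union.1 ha with ha | ha
    · exact ⟨a, ha, h'⟩
    · have := h a ha
      omega
  · rintro ⟨a, ha, h'⟩
    exact ⟨a, Finset.mem_union_left _ ha, h'⟩
  · rintro ⟨a, ha, h'⟩
    rcases Finset.mem_union.1 ha with ha | ha
    · exact ⟨a, ha, h'⟩
    · have := h a ha
      omega
  · rintro ⟨a, ha, h'⟩
    exact ⟨a, Finset.mem_union_left _ ha, h'⟩

theorem neighborFactor_union_right {j i : ℕ} (hi : j < i) {A B : Finset ℕ}
    (hA : A ⊆ Finset.range j) : neighborFactor i (A ∪ B) = neighborFactor i B := by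
  have h : ∀ x ∈ A, x < j := fun x hx => Finset.mem_range.1 (hA hx)
  rw [neighborFactor, neighborFactor]
  congr 1 <;> refine if_congr ⟨?_, ?_⟩ rfl rfl
  · rintro ⟨a, ha, h'⟩
    rcases Finset.mem_union.1 ha with ha | ha
    · have := h a ha
      omega
    · exact ⟨a, ha, h'⟩
  · rintro ⟨a, ha, h'⟩
    exact ⟨a, Finset.mem_union_right _ ha, h'⟩
  · rintro ⟨a, ha, h'⟩
    rcases Finset.mem_union.1 ha with ha | ha
    · have := h a ha
      omega
    · exact ⟨a, ha, h'⟩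
  · rintro ⟨a, ha, h'⟩
    exact ⟨a, Finset.mem_union_right _ ha, h'⟩

/-- The Riccati equation read on coefficients. Removing position j first leaves a prefix and a
suffix that do not interact, so `elimSum_union` splits the remaining sum; the neighbour factor of j
itself is exactly what turns `wordPoly` into `leftPoly` and `rightPoly`. -/
theorem C_sum_mul_wordPoly (l : List ℕ) (hl : ∀ b ∈ l, 0 < b) :
    C (l.sum : ℚ) * wordPoly l =
      ∑ j ∈ Finset.range l.length, leftPoly (l.take j) * rightPoly (l.drop (j + 1)) := by
  have hpos : ∀ i < l.length, (0 : ℚ) < (l.getD i 0 : ℚ) := by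
    intro i hi
    rw [List.getD_eq_getElem _ _ hi]
    exact_mod_cast hl _ (List.getElem_mem hi)
  rw [wordPoly, ← sum_range_getD, C_sum_mul_elimSum _ _ fun i hi => hpos i (Finset.mem_range.1 hi)]
  refine Finset.sum_congr rfl fun j hj => ?_
  rw [Finset.mem_range] at hj
  have hE : (Finset.range l.length).erase j =
      Finset.range j ∪ Finset.Ico (j + 1) l.length := by
    ext x
    simp only [Finset.mem_erase, Finset.mem_range, Finset.mem_union, Finset.mem_Ico]
    omega
  have hd : Disjoint (Finset.range j) (Finset.Ico (j + 1) l.length) := by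
    rw [Finset.disjoint_left]
    intro x hx
    simp only [Finset.mem_range, Finset.mem_Ico] at hx ⊢
    omega
  rw [hE, elimSum_union _ _ _ _ _ rfl hd, elimSum_range_eq_wordPoly_take l hj.le,
    elimSum_Ico_eq_wordPoly_drop]
  · have h1 : (∃ i ∈ Finset.range j ∪ Finset.Ico (j + 1) l.length, i + 1 = j) ↔
        ¬ l.take j = [] := by
      simp only [Finset.mem_union, Finset.mem_range, Finset.mem_Ico, List.take_eq_nil_iff]
      constructor
      · rintro ⟨i, hi, rfl⟩ h
        rcases h with h | h
        · omega
        · simp [h] at hj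
      · intro h
        exact ⟨j - 1, by omega, by omega⟩
    have h2 : (∃ i ∈ Finset.range j ∪ Finset.Ico (j + 1) l.length, i = j + 1) ↔
        ¬ l.drop (j + 1) = [] := by
      simp only [Finset.mem_union, Finset.mem_range, Finset.mem_Ico, List.drop_eq_nil_iff]
      constructor
      · rintro ⟨i, hi, rfl⟩
        omega
      · intro h
        exact ⟨j + 1, by omega, rfl⟩
    rw [neighborFactor, leftPoly, rightPoly]
    by_cases hl : l.take j = [] <;> by_cases hr : l.drop (j + 1) = [] <;>
      simp only [h1, h2, hl, hr, wordPoly_nil, not_true, not_false_iff, if_true, if_false] <;> ring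
  · intro i hi
    rw [← hE] at hi
    exact hpos i (Finset.mem_range.1 (Finset.mem_of_mem_erase hi))
  · exact fun i hi A' _ B' hB' => neighborFactor_union_left (Finset.mem_range.1 hi) hB'
  · exact fun i hi A' hA' B' _ => neighborFactor_union_right (Finset.mem_Ico.1 hi).1 hA'

/-! ### Words and permutations -/

/-- Each of the r - 1 adjacent pairs is either an ascent or a descent. -/
theorem card_ascents_add_numDescents {r : ℕ} (s : Equiv.Perm (Fin r)) :
    (Finset.univ.filter fun p : Fin r => ∃ q : Fin r, (q : ℕ) = p + 1 ∧ s p < s q).card +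
      numDescents s = r - 1 := by
  have h1 : numDescents s =
      (Finset.univ.filter fun p : Fin r => ∃ q : Fin r, (q : ℕ) = p + 1 ∧ s q < s p).card := by
    rw [numDescents, Nat.card_eq_fintype_card, Fintype.card_subtype]
    congr 1
    refine Finset.filter_congr fun p _ => ⟨?_, ?_⟩
    · rintro ⟨h, h'⟩
      exact ⟨_, rfl, h'⟩
    · rintro ⟨q, h, h'⟩
      have hq : q = ⟨p + 1, h ▸ q.2⟩ := Fin.ext h
      exact ⟨h ▸ q.2, hq ▸ h'⟩
  have h2 : (Finset.univ.filter fun p : Fin r => (p : ℕ) + 1 < r).card = r - 1 := by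
    rw [← Finset.card_range (r - 1)]
    refine Finset.card_bij (fun p _ => (p : ℕ)) ?_ ?_ ?_
    · intro p hp
      simp only [Finset.mem_filter, Finset.mem_univ, true_and, Finset.mem_range] at hp ⊢
      omega
    · exact fun p _ q _ h => Fin.ext h
    · intro x hx
      rw [Finset.mem_range] at hx
      exact ⟨⟨x, by omega⟩, by simp; omega, rfl⟩
  rw [h1, ← h2, ← Finset.card_union_of_disjoint]
  · congr 1
    ext p
    simp only [Finset.mem_union, Finset.mem_filter, Finset.mem_univ, true_and]
    constructor
    · rintro (⟨q, h, -⟩ | ⟨q, h, -⟩) <;> omega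
    · intro h
      rcases lt_trichotomy (s p) (s ⟨p + 1, h⟩) with h' | h' | h'
      · exact Or.inl ⟨_, rfl, h'⟩
      · have := congrArg Fin.val (s.injective h')
        simp at this
      · exact Or.inr ⟨_, rfl, h'⟩
  · rw [Finset.disjoint_filter]
    rintro p - ⟨q, h, h'⟩ ⟨q', h1, h1'⟩
    obtain rfl : q = q' := Fin.ext (by omega)
    exact lt_asymm h' h1'

/-- Descents are counted here by their right end instead of their left end, the form in which right
neighbours produce them. -/
theorem card_predecessors_eq_numDescents {r : ℕ} (s : Equiv.Perm (Fin r)) :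
    (Finset.univ.filter fun p : Fin r => ∃ q : Fin r, (q : ℕ) + 1 = p ∧ s p < s q).card =
      numDescents s := by
  rw [numDescents, Nat.card_eq_fintype_card, Fintype.card_subtype]
  refine (Finset.card_bij (fun p hp => ⟨p + 1, (Finset.mem_filter.1 hp).2.1⟩) ?_ ?_ ?_).symm
  · intro p hp
    obtain ⟨h, h'⟩ := (Finset.mem_filter.1 hp).2
    exact Finset.mem_filter.2 ⟨Finset.mem_univ _, p, rfl, h'⟩
  · intro p _ q _ h
    simpa [Fin.ext_iff] using h
  · intro p hp
    obtain ⟨q, h, h'⟩ := (Finset.mem_filter.1 hp).2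
    have hp' : p = ⟨q + 1, h ▸ p.2⟩ := Fin.ext h.symm
    exact ⟨q, Finset.mem_filter.2 ⟨Finset.mem_univ _, h ▸ p.2, hp' ▸ h'⟩, hp'.symm⟩

/-- The coefficient of `t_1^{e_1 - 1} ⋯ t_r^{e_r - 1}` under integration over the simplex. -/
def simplexWeight {r : ℕ} (e : Fin r → ℕ) : ℚ := ∏ i, (∑ i' ∈ Finset.Ici i, (e i' : ℚ))⁻¹

theorem prod_ite_const_one {ι M : Type*} [Fintype ι] [CommMonoid M] (p : ι → Prop)
    [DecidablePred p] (a : M) :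
    ∏ i, (if p i then a else 1) = a ^ (Finset.univ.filter p).card := by
  rw [Finset.prod_ite, Finset.prod_const, Finset.prod_const_one, mul_one]

/-- In h(t_σ(r)) ⋯ h(t_σ(1)) the i-th variable stands at position (σ⁻¹ i).rev. Removing the
positions in the order of their variables, outermost first, matches elimination orders with
permutations and turns the running sums into `simplexWeight`. -/
theorem wordPoly_ofFn {r : ℕ} (a : Fin r → ℕ) :
    wordPoly (List.ofFn a) = ∑ s : Equiv.Perm (Fin r),
      C (simplexWeight fun i => a (s.symm i).rev) *
        ((1 - X) ^ (r - 1 - numDescents s) * (-X) ^ numDescents s) := by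
  have h0 : (Finset.univ.map (Fin.valEmbedding : Fin r ↪ ℕ)) =
      Finset.range (List.ofFn a).length := by
    ext x
    simp only [Finset.mem_map, Finset.mem_univ, true_and, Fin.valEmbedding_apply,
      List.length_ofFn, Finset.mem_range]
    exact ⟨fun ⟨y, h⟩ => h ▸ y.2, fun h => ⟨⟨x, h⟩, rfl⟩⟩
  rw [wordPoly, ← h0, ← elimSum_map (fun i => (a i : ℚ))
    (fun j B => neighborFactor j (B.map Fin.valEmbedding)) Fin.valEmbedding
    (fun i => ((List.ofFn a).getD i 0 : ℚ)) neighborFactor Finset.univ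
    (fun i _ => by simp [List.getD_eq_getElem?_getD]) (fun _ _ _ _ => rfl),
    elimSum_univ_eq_sum_perm]
  -- The permutation s corresponds to the removal order i ↦ (s⁻¹ i).rev.
  refine (Finset.sum_equiv ((Equiv.inv (Equiv.Perm (Fin r))).trans
    (Equiv.mulLeft (Fin.revPerm : Equiv.Perm (Fin r)))) (by simp) fun s _ => ?_).symm
  have hcoe : ∀ i, ((Equiv.inv (Equiv.Perm (Fin r))).trans
      (Equiv.mulLeft (Fin.revPerm : Equiv.Perm (Fin r)))) s i = (s.symm i).rev := fun _ => rfl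
  rw [orderWeight, Finset.prod_mul_distrib]
  simp only [hcoe]
  rw [simplexWeight, map_prod]
  congr 1
  simp only [neighborFactor, Finset.prod_mul_distrib]
  rw [← card_ascents_add_numDescents s, Nat.add_sub_cancel]
  congr 1
  -- The reversal makes p + 1 the left neighbour of p; it is still present when p is removed iff s p
  -- < s (p + 1), an ascent.
  · rw [← prod_ite_const_one]
    refine Fintype.prod_equiv s _ _ fun p => if_congr ?_ rfl rfl
    simp only [Finset.mem_map, Finset.mem_image, Finset.mem_Ioi, Fin.valEmbedding_apply,
      Equiv.symm_apply_apply]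
    constructor
    · rintro ⟨q, h, h'⟩
      exact ⟨_, ⟨_, ⟨s q, h', rfl⟩, rfl⟩, by simp [Fin.val_rev]; omega⟩
    · rintro ⟨_, ⟨_, ⟨i, hi, rfl⟩, rfl⟩, h⟩
      refine ⟨s.symm i, ?_, by simpa using hi⟩
      have h1 := (s.symm i).2
      have h2 := p.2
      simp only [hcoe, Fin.val_rev] at h
      omega
  -- The right neighbour is p - 1, still present iff s p < s (p - 1), which is a descent at p - 1.
  · rw [← card_predecessors_eq_numDescents s, ← prod_ite_const_one]
    refine Fintype.prod_equiv s _ _ fun p => if_congr ?_ rfl rfl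
    simp only [Finset.mem_map, Finset.mem_image, Finset.mem_Ioi, Fin.valEmbedding_apply,
      Equiv.symm_apply_apply]
    constructor
    · rintro ⟨q, h, h'⟩
      exact ⟨_, ⟨_, ⟨s q, h', rfl⟩, rfl⟩, by simp [Fin.val_rev]; omega⟩
    · rintro ⟨_, ⟨_, ⟨i, hi, rfl⟩, rfl⟩, h⟩
      refine ⟨s.symm i, ?_, by simpa using hi⟩
      have h1 := (s.symm i).2
      have h2 := p.2
      simp only [hcoe, Fin.val_rev] at h
      omega

end WordPoly

/-! ### Integration over the unit interval -/

section UnitIntegral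

open Polynomial

variable {A : Type*} [Ring A] [Algebra ℚ A]

/-- `∫_0^1 p(x) dx`. -/
def unitIntegral (p : A[X]) : A := p.sum fun k a => (1 / ((k : ℚ) + 1)) • a

theorem unitIntegral_add (p q : A[X]) :
    unitIntegral (p + q) = unitIntegral p + unitIntegral q :=
  Polynomial.sum_add_index p q _ (fun _ => smul_zero _) fun _ _ _ => smul_add _ _ _

theorem unitIntegral_zero : unitIntegral (0 : A[X]) = 0 := Polynomial.sum_zero_index _

theorem unitIntegral_sum {ι : Type*} (s : Finset ι) (f : ι → A[X]) :
    unitIntegral (∑ i ∈ s, f i) = ∑ i ∈ s, unitIntegral (f i) :=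
  map_sum (⟨⟨unitIntegral, unitIntegral_zero⟩, unitIntegral_add⟩ : A[X] →+ A) f s

theorem unitIntegral_monomial (k : ℕ) (a : A) :
    unitIntegral (monomial k a) = (1 / ((k : ℚ) + 1)) • a :=
  Polynomial.sum_monomial_index a _ (smul_zero _)

theorem unitIntegral_aeval_mul_C (p : ℚ[X]) (a : A) :
    unitIntegral (aeval (X : A[X]) p * C a) = unitIntegral p • a := by
  induction p using Polynomial.induction_on' with
  | add p q hp hq => rw [map_add, add_mul, unitIntegral_add, hp, hq, unitIntegral_add, add_smul]
  | monomial k c =>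
    have : aeval (X : A[X]) (monomial k c) * C a = monomial k (c • a) := by
      rw [aeval_monomial, mul_assoc, X_pow_mul_C, ← C_mul_X_pow_eq_monomial, ← mul_assoc,
        ← Algebra.smul_def, smul_C]
    rw [this, unitIntegral_monomial, unitIntegral_monomial, smul_smul, smul_eq_mul]

theorem unitIntegral_C_mul (c : ℚ) (p : ℚ[X]) :
    unitIntegral (C c * p) = c * unitIntegral p := by
  have := unitIntegral_aeval_mul_C p c
  simpa [mul_comm] using this

/-- The Beta integral, by induction on the exponent of 1 - X: the splitting 1 = (1 - X) + X
expresses the new integral as a difference of two known ones. -/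
theorem unitIntegral_X_pow_mul (e : ℕ) : ∀ d : ℕ, unitIntegral (((1 : ℚ[X]) - X) ^ e * X ^ d) =
    ((d + e + 1 : ℕ) : ℚ)⁻¹ * ((d + e).choose d : ℚ)⁻¹ := by
  induction e with
  | zero =>
    intro d
    rw [pow_zero, one_mul, ← monomial_one_right_eq_X_pow, unitIntegral_monomial]
    simp
  | succ e ih =>
    intro d
    have h : ((1 : ℚ[X]) - X) ^ e * X ^ d =
        (1 - X) ^ (e + 1) * X ^ d + (1 - X) ^ e * X ^ (d + 1) := by
      ring
    have h' := congrArg unitIntegral h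
    rw [unitIntegral_add, ih, ih] at h'
    rw [← sub_eq_iff_eq_add.2 h']
    have h1 : ((d + e).choose d : ℚ) * (d + e + 1) = (d + e + 1).choose d * (e + 1) := by
      have := Nat.choose_mul_succ_eq (d + e) d
      rw [show d + e + 1 - d = e + 1 by omega] at this
      exact_mod_cast this
    have h2 : (d + e + 1 : ℚ) * (d + e).choose d = (d + e + 1).choose (d + 1) * (d + 1) := by
      exact_mod_cast Nat.add_one_mul_choose_eq (d + e) d
    have hp : ((d + e).choose d : ℚ) ≠ 0 :=
      Nat.cast_ne_zero.2 (Nat.choose_pos (Nat.le_add_right d e)).ne'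
    have hd : (d : ℚ) + 1 ≠ 0 := by positivity
    have he : (e : ℚ) + 1 ≠ 0 := by positivity
    have hde : (d : ℚ) + e + 1 ≠ 0 := by positivity
    have hde' : (d : ℚ) + e + 2 ≠ 0 := by positivity
    rw [show d + 1 + e = d + e + 1 by ring, show d + (e + 1) = d + e + 1 by ring,
      eq_div_of_mul_eq hd h2.symm, eq_div_of_mul_eq he h1.symm]
    push_cast
    rw [show (d : ℚ) + e + 1 + 1 = d + e + 2 by ring]
    field_simp
    ring

theorem unitIntegral_descent {r : ℕ} (hr : 0 < r) (s : Equiv.Perm (Fin r)) :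
    unitIntegral ((1 - X) ^ (r - 1 - numDescents s) * (-X) ^ numDescents s : ℚ[X]) =
      descentWeight s := by
  have h := card_ascents_add_numDescents s
  rw [neg_pow, ← C_1, ← C_neg, ← C_pow, mul_left_comm, unitIntegral_C_mul, C_1,
    unitIntegral_X_pow_mul, descentWeight,
    show numDescents s + (r - 1 - numDescents s) = r - 1 by omega, Nat.sub_add_cancel hr]
  ring

end UnitIntegral

/-! ### Power series over a noncommutative ring -/

section Euler

variable {A : Type*} [Ring A]

/-- The derivation `t d/dt`. -/
def euler (f : A⟦X⟧) : A⟦X⟧ := PowerSeries.mk fun m => m • PowerSeries.coeff m f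

@[simp] theorem coeff_euler (m : ℕ) (f : A⟦X⟧) :
    PowerSeries.coeff m (euler f) = m • PowerSeries.coeff m f := PowerSeries.coeff_mk _ _

theorem euler_add (f g : A⟦X⟧) : euler (f + g) = euler f + euler g := by
  ext m
  simp

theorem euler_sub (f g : A⟦X⟧) : euler (f - g) = euler f - euler g := by
  ext m
  simp [mul_sub]

theorem euler_one : euler (1 : A⟦X⟧) = 0 := by
  ext m
  rcases m with _ | m <;> simp [PowerSeries.coeff_one]

theorem euler_mul (f g : A⟦X⟧) : euler (f * g) = euler f * g + f * euler g := by
  ext m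
  rw [coeff_euler, map_add, PowerSeries.coeff_mul, PowerSeries.coeff_mul, PowerSeries.coeff_mul,
    Finset.smul_sum, ← Finset.sum_add_distrib]
  refine Finset.sum_congr rfl fun p hp => ?_
  rw [coeff_euler, coeff_euler, ← mem_antidiagonal.1 hp, add_smul, smul_mul_assoc,
    mul_smul_comm]

theorem euler_C_mul (a : A) (f : A⟦X⟧) :
    euler (PowerSeries.C a * f) = PowerSeries.C a * euler f := by
  ext m
  simp only [coeff_euler, PowerSeries.coeff_C_mul, mul_smul_comm]

theorem coeff_pow_eq_zero {f : A⟦X⟧} (hf : PowerSeries.coeff 0 f = 0) (k : ℕ) :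
    ∀ m < k, PowerSeries.coeff m (f ^ k) = 0 := by
  induction k with
  | zero => intro m hm; omega
  | succ k ih =>
    intro m hm
    rw [pow_succ, PowerSeries.coeff_mul]
    refine Finset.sum_eq_zero fun p hp => ?_
    rw [mem_antidiagonal] at hp
    rcases Nat.eq_zero_or_pos p.2 with h | h
    · rw [h, hf, mul_zero]
    · rw [ih p.1 (by omega), zero_mul]

/-- Uniqueness for a linear equation. Since a and b have no constant term, m times the m-th
coefficient of f is determined by lower coefficients, and m is invertible. -/
theorem eq_zero_of_euler_eq [Algebra ℚ A] {f a b : A⟦X⟧} (ha : PowerSeries.coeff 0 a = 0)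
    (hb : PowerSeries.coeff 0 b = 0) (hf : PowerSeries.coeff 0 f = 0)
    (h : euler f = a * f + f * b) : f = 0 := by
  ext m
  rw [map_zero]
  induction m using Nat.strong_induction_on with
  | _ m ih =>
    rcases Nat.eq_zero_or_pos m with rfl | hm
    · exact hf
    · have h' := congrArg (PowerSeries.coeff m) h
      rw [coeff_euler, map_add, PowerSeries.coeff_mul, PowerSeries.coeff_mul,
        Finset.sum_eq_zero, Finset.sum_eq_zero, add_zero] at h'
      · rw [← Nat.cast_smul_eq_nsmul ℚ] at h'
        exact (smul_eq_zero_iff_right (Nat.cast_ne_zero.2 hm.ne' : (m : ℚ) ≠ 0)).1 h'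
      · intro p hp
        rw [mem_antidiagonal] at hp
        rcases Nat.eq_zero_or_pos p.2 with h | h
        · rw [h, hb, mul_zero]
        · rw [ih p.1 (by omega), zero_mul]
      · intro p hp
        rw [mem_antidiagonal] at hp
        rcases Nat.eq_zero_or_pos p.1 with h | h
        · rw [h, ha, zero_mul]
        · rw [ih p.2 (by omega), mul_zero]

end Euler

/-! ### Series indexed by words -/

section Words

/-- The words in positive letters with sum `m`. -/
def compWords (m : ℕ) : Finset (List ℕ) :=
  (Finset.univ : Finset (Composition m)).image Composition.blocks

theorem mem_compWords {m : ℕ} {l : List ℕ} :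
    l ∈ compWords m ↔ (∀ b ∈ l, 0 < b) ∧ l.sum = m := by
  rw [compWords, Finset.mem_image]
  constructor
  · rintro ⟨c, -, rfl⟩
    exact ⟨fun b hb => c.blocks_pos hb, c.blocks_sum⟩
  · rintro ⟨h, h'⟩
    exact ⟨⟨l, fun {b} hb => h b hb, h'⟩, Finset.mem_univ _, rfl⟩

variable {A : Type*} [Ring A]

/-- `∑ φ(l) γ_{l_1} ⋯ γ_{l_r} t^{l_1 + ⋯ + l_r}`, summed over all words `l`. -/
def wordSeries (γ : ℕ → A) (φ : List ℕ → A) : A⟦X⟧ :=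
  PowerSeries.mk fun m => ∑ l ∈ compWords m, φ l * (l.map γ).prod

theorem coeff_wordSeries (γ : ℕ → A) (φ : List ℕ → A) (m : ℕ) :
    PowerSeries.coeff m (wordSeries γ φ) = ∑ l ∈ compWords m, φ l * (l.map γ).prod :=
  PowerSeries.coeff_mk _ _

theorem wordSeries_add (γ : ℕ → A) (φ ψ : List ℕ → A) :
    wordSeries γ (fun l => φ l + ψ l) = wordSeries γ φ + wordSeries γ ψ := by
  ext m
  simp only [map_add, coeff_wordSeries, add_mul, Finset.sum_add_distrib]

theorem wordSeries_mul_left (γ : ℕ → A) (a : A) (φ : List ℕ → A) :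
    wordSeries γ (fun l => a * φ l) = PowerSeries.C a * wordSeries γ φ := by
  ext m
  simp only [PowerSeries.coeff_C_mul, coeff_wordSeries, Finset.mul_sum, mul_assoc]

theorem wordSeries_nil (γ : ℕ → A) :
    wordSeries γ (fun l => if l = [] then 1 else 0) = 1 := by
  ext m
  rw [coeff_wordSeries, PowerSeries.coeff_one]
  simp only [ite_mul, zero_mul, one_mul]
  rw [Finset.sum_ite_eq' (compWords m) [] fun l => (l.map γ).prod]
  simp [mem_compWords, eq_comm]

/-- A term of the triple product is a word with a distinguished letter. Terms whose middle letter is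
0 are not words in positive letters, but they vanish because `γ 0 = 0`; centrality of the values of
v lets them pass to the front. -/
theorem wordSeries_mul_mul (γ : ℕ → A) (hγ : γ 0 = 0) (u v : List ℕ → A)
    (hv : ∀ l a, Commute (v l) a) :
    wordSeries γ u * PowerSeries.mk γ * wordSeries γ v = wordSeries γ fun l =>
      ∑ j ∈ Finset.range l.length, u (l.take j) * v (l.drop (j + 1)) := by
  ext m
  rw [coeff_wordSeries, PowerSeries.coeff_mul]
  simp only [PowerSeries.coeff_mul, coeff_wordSeries, PowerSeries.coeff_mk, Finset.sum_mul,
    Finset.mul_sum, Finset.sum_sigma']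
  symm
  have hspl : ∀ (l : List ℕ) (j : ℕ), j < l.length →
      l.take j ++ l.getD j 0 :: l.drop (j + 1) = l := by
    intro l j hj
    rw [List.getD_eq_getElem _ _ hj, ← List.drop_eq_getElem_cons hj, List.take_append_drop]
  refine Finset.sum_of_injOn (fun x => ⟨((x.1.take x.2).sum + x.1.getD x.2 0,
    (x.1.drop (x.2 + 1)).sum), x.1.drop (x.2 + 1), ((x.1.take x.2).sum, x.1.getD x.2 0),
    x.1.take x.2⟩) ?_ ?_ ?_ ?_
  · rintro ⟨l, j⟩ hx ⟨l', j'⟩ hx' h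
    simp only [Finset.coe_sigma, Set.mem_sigma_iff, Finset.mem_coe, Finset.mem_range] at hx hx'
    simp only [Sigma.mk.injEq, Prod.mk.injEq, heq_eq_eq] at h
    obtain ⟨-, h1, ⟨-, h2⟩, h3⟩ := h
    have hl : l = l' := by rw [← hspl l j hx.2, ← hspl l' j' hx'.2, h1, h2, h3]
    have hj : j = j' := by
      have := congrArg List.length h3
      rwa [List.length_take_of_le hx.2.le, List.length_take_of_le hx'.2.le] at this
    rw [hl, hj]
  · rintro ⟨l, j⟩ hx
    simp only [Finset.coe_sigma, Set.mem_sigma_iff, Finset.mem_coe, Finset.mem_range,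
      mem_compWords] at hx
    obtain ⟨⟨hpos, hsum⟩, hj⟩ := hx
    have hs : (l.take j).sum + l.getD j 0 + (l.drop (j + 1)).sum = m := by
      rw [← hsum]
      conv_rhs => rw [← hspl l j hj]
      rw [List.sum_append, List.sum_cons, add_assoc]
    simp only [Finset.coe_sigma, Set.mem_sigma_iff, Finset.mem_coe, mem_antidiagonal,
      mem_compWords, and_true]
    exact ⟨hs, fun b hb => hpos b (List.mem_of_mem_drop hb), trivial,
      fun b hb => hpos b (List.mem_of_mem_take hb)⟩
  · rintro ⟨⟨p1, p2⟩, l2, ⟨q1, q2⟩, l1⟩ hx hn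
    simp only [Finset.mem_sigma, mem_antidiagonal, mem_compWords] at hx
    obtain ⟨hp, ⟨h2, h2'⟩, hq, h1, h1'⟩ := hx
    rcases Nat.eq_zero_or_pos q2 with rfl | hq2
    · simp [hγ]
    · refine absurd ⟨⟨l1 ++ q2 :: l2, l1.length⟩, ?_, ?_⟩ hn
      · simp only [Finset.coe_sigma, Set.mem_sigma_iff, Finset.mem_coe, Finset.mem_range,
          mem_compWords]
        refine ⟨⟨?_, ?_⟩, by simp⟩
        · intro b hb
          rcases List.mem_append.1 hb with hb | hb
          · exact h1 b hb
          · rcases List.mem_cons.1 hb with rfl | hb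
            · exact hq2
            · exact h2 b hb
        · rw [List.sum_append, List.sum_cons, h1', h2', ← hp, ← hq, add_assoc]
      · have hd : (l1 ++ q2 :: l2).drop (l1.length + 1) = l2 := by
          simp [List.drop_append]
        simp [List.getD_eq_getElem?_getD, hd, h1', h2', hq]
  · rintro ⟨l, j⟩ hx
    simp only [Finset.mem_sigma, Finset.mem_range] at hx
    have : (l.map γ).prod = ((l.take j).map γ).prod * (γ (l.getD j 0) *
        ((l.drop (j + 1)).map γ).prod) := by
      conv_lhs => rw [← hspl l j hx.2]
      rw [List.map_append, List.prod_append, List.map_cons, List.prod_cons]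
    simp only [this, mul_assoc]
    rw [← mul_assoc (v _), (hv _ _).eq, mul_assoc, ← mul_assoc (v _) (γ _), (hv _ _).eq, mul_assoc]

/-! ### The Riccati equation -/

variable [Algebra ℚ A]

open Polynomial in
/-- The word series with coefficients `wordPoly`, without its constant term. -/
def riccati (γ : ℕ → A) (z : A) : A⟦X⟧ :=
  wordSeries γ fun l => if l = [] then 0 else aeval z (wordPoly l)

open Polynomial in
-- A word contributes to t to the power of its letter sum, so θ multiplies its coefficient by that
-- sum and `C_sum_mul_wordPoly` applies word by word.
theorem euler_riccati (γ : ℕ → A) (hγ : γ 0 = 0) (z : A) (hz : ∀ a, Commute z a) :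
    euler (riccati γ z) = (1 + (1 - PowerSeries.C z) * riccati γ z) * PowerSeries.mk γ *
      (1 - PowerSeries.C z * riccati γ z) := by
  have hc : ∀ (p : ℚ[X]) (a : A), Commute (aeval z p) a := by
    intro p a
    induction p using Polynomial.induction_on' with
    | add p q hp hq => rw [map_add]; exact hp.add_left hq
    | monomial k c =>
      rw [aeval_monomial]
      exact Commute.mul_left (Algebra.commutes c a) ((hz a).pow_left k)
  have hL : wordSeries γ (fun l => aeval z (leftPoly l)) =
      1 + (1 - PowerSeries.C z) * riccati γ z := by
    rw [riccati, ← map_one PowerSeries.C, ← map_sub, ← wordSeries_mul_left, map_one,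
      ← wordSeries_nil γ, ← wordSeries_add]
    congr 1
    funext l
    rw [leftPoly]
    split_ifs <;> simp
  have hR : wordSeries γ (fun l => aeval z (rightPoly l)) =
      1 - PowerSeries.C z * riccati γ z := by
    rw [← wordSeries_nil γ, riccati, sub_eq_add_neg, ← neg_mul, ← map_neg, ← wordSeries_mul_left,
      ← wordSeries_add]
    congr 1
    funext l
    rw [rightPoly]
    split_ifs <;> simp
  rw [← hL, ← hR, wordSeries_mul_mul γ hγ _ _ fun l a => hc _ a]
  ext m
  rw [coeff_euler, riccati, coeff_wordSeries, coeff_wordSeries, Finset.smul_sum]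
  refine Finset.sum_congr rfl fun l hl => ?_
  obtain ⟨hpos, hsum⟩ := mem_compWords.1 hl
  rw [← smul_mul_assoc]
  congr 1
  rcases eq_or_ne l [] with rfl | hne
  · simp
  · rw [if_neg hne]
    have := congrArg (aeval z) (C_sum_mul_wordPoly l hpos)
    simp only [map_mul, map_sum, hsum, map_natCast] at this
    rw [← this, nsmul_eq_mul]

theorem coeff_zero_riccati (γ : ℕ → A) (z : A) : PowerSeries.coeff 0 (riccati γ z) = 0 := by
  rw [riccati, coeff_wordSeries]
  refine Finset.sum_eq_zero fun l hl => ?_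
  obtain ⟨hpos, hsum⟩ := mem_compWords.1 hl
  have : l = [] := by
    rcases l with _ | ⟨b, l⟩
    · rfl
    · have := hpos b (by simp)
      simp at hsum
      omega
  simp [this]

/-- Identifies the word series with P = (E - 1)(1 + z(E - 1))⁻¹ without inverting anything. The
defect f = P(1 + z(E - 1)) - (E - 1) satisfies the homogeneous linear equation θf = -(1 + (1 - z)P)
G z f + f G, with G the series of γ, and has no constant term, so it vanishes. -/
theorem riccati_mul (γ : ℕ → A) (hγ : γ 0 = 0) (z : A) (hz : ∀ a, Commute z a) (E : A⟦X⟧)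
    (hE0 : PowerSeries.coeff 0 E = 1) (hE : euler E = E * PowerSeries.mk γ) :
    riccati γ z * (1 + PowerSeries.C z * (E - 1)) = E - 1 := by
  have hZ : ∀ f : A⟦X⟧, f * PowerSeries.C z = PowerSeries.C z * f := by
    intro f
    ext m
    rw [PowerSeries.coeff_mul_C, PowerSeries.coeff_C_mul, (hz _).eq]
  have hZe := fun f : A⟦X⟧ => euler_C_mul z f
  have hP := euler_riccati γ hγ z hz
  have hP0 := coeff_zero_riccati γ z
  have hγ0 : PowerSeries.coeff 0 (PowerSeries.mk γ) = 0 := by rw [PowerSeries.coeff_mk, hγ]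
  generalize riccati γ z = P at *
  generalize PowerSeries.mk γ = G at *
  generalize PowerSeries.C z = Z at *
  rw [← sub_eq_zero]
  have hVS : (1 - Z * P) * (1 + Z * (E - 1)) =
      1 - Z * (P * (1 + Z * (E - 1)) - (E - 1)) := by noncomm_ring
  have hVE : (1 - Z * P) * E = 1 + (1 - Z) * P - (P * (1 + Z * (E - 1)) - (E - 1)) := by
    rw [mul_add P, ← mul_assoc P Z, hZ P]
    noncomm_ring
  simp only [PowerSeries.coeff_zero_eq_constantCoeff_apply] at hP0 hE0 hγ0
  refine eq_zero_of_euler_eq (a := -((1 + (1 - Z) * P) * G * Z)) (b := G) ?_ ?_ ?_ ?_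
  · simp [hγ0]
  · simp [hγ0]
  · simp [hP0, hE0]
  · rw [euler_sub, euler_mul, euler_add, hZe, euler_sub, euler_one, hP, hE, mul_assoc _ _ (1 + _),
      hVS, zero_add, sub_zero, ← mul_assoc P Z, hZ P,
      show P * (1 + Z * (E - 1)) - (E - 1) = 1 + (1 - Z) * P - (1 - Z * P) * E by rw [hVE]; abel]
    noncomm_ring

/-- Iterating P = y - zPy with y = E - 1 gives a finite geometric sum with explicit remainder. -/
theorem riccati_eq_sum (γ : ℕ → A) (hγ : γ 0 = 0) (z : A) (hz : ∀ a, Commute z a) (E : A⟦X⟧)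
    (hE0 : PowerSeries.coeff 0 E = 1) (hE : euler E = E * PowerSeries.mk γ) (N : ℕ) :
    riccati γ z = ∑ k ∈ Finset.range N, PowerSeries.C ((-z) ^ k) * (E - 1) ^ (k + 1) +
      PowerSeries.C ((-z) ^ N) * riccati γ z * (E - 1) ^ N := by
  have hZ : ∀ f : A⟦X⟧, f * PowerSeries.C z = PowerSeries.C z * f := by
    intro f
    ext m
    rw [PowerSeries.coeff_mul_C, PowerSeries.coeff_C_mul, (hz _).eq]
  have h := riccati_mul γ hγ z hz E hE0 hE
  induction N with
  | zero => simp
  | succ N ih =>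
    conv_lhs => rw [ih]
    rw [Finset.sum_range_succ, add_assoc]
    congr 1
    have h' : riccati γ z = (E - 1) + PowerSeries.C (-z) * riccati γ z * (E - 1) := by
      rw [mul_add, mul_one, ← mul_assoc, hZ] at h
      rw [map_neg, neg_mul, neg_mul, ← sub_eq_add_neg]
      exact eq_sub_of_add_eq h
    conv_lhs => rw [h']
    rw [pow_succ (-z), map_mul, pow_succ' (E - 1)]
    noncomm_ring

end Words

/-! ### The logarithm as an integral over the auxiliary parameter -/

section Logarithm

open Polynomial

variable {A : Type*} [Ring A] [Algebra ℚ A]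

/-- The parameter z is taken to be the central indeterminate of A[X] and integrated over [0, 1]: the
geometric terms (-z)^k y^(k+1) become (-1)^k / (k + 1) · y^(k+1), the logarithm series in y = E - 1.
-/
theorem sum_wordPoly_eq_log (γ : ℕ → A) (hγ : γ 0 = 0) (E : A⟦X⟧)
    (hE0 : PowerSeries.coeff 0 E = 1) (hE : euler E = E * PowerSeries.mk γ) (m : ℕ) :
    ∑ l ∈ compWords m, (if l = [] then 0 else unitIntegral (wordPoly l)) • (l.map γ).prod =
      ∑ k ∈ Finset.range m,
        ((-1) ^ k / ((k : ℚ) + 1)) • PowerSeries.coeff m ((E - 1) ^ (k + 1)) := by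
  have hX : ∀ p : A[X], Commute X p := fun p => Polynomial.commute_X p
  have hmap : PowerSeries.map (C : A →+* A[X]) (PowerSeries.mk γ) =
      PowerSeries.mk fun b => C (γ b) := by
    ext1 k
    simp
  have hE0' : PowerSeries.coeff 0 (PowerSeries.map (C : A →+* A[X]) E) = 1 := by
    rw [PowerSeries.coeff_map, hE0, map_one]
  have hE' : euler (PowerSeries.map (C : A →+* A[X]) E) =
      PowerSeries.map (C : A →+* A[X]) E * PowerSeries.mk fun b => C (γ b) := by
    rw [← hmap, ← map_mul, ← hE]
    ext1 k
    simp
  have h := congrArg (fun f => unitIntegral (PowerSeries.coeff m f))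
    (riccati_eq_sum (fun b => C (γ b)) (by rw [hγ, map_zero]) X hX _ hE0' hE' m)
  -- The remainder after m steps starts in degree m + 1: y^m contributes order m and P has no
  -- constant term.
  have h0 : PowerSeries.coeff m (PowerSeries.C ((-X) ^ m) * riccati (fun b => C (γ b)) X *
      (PowerSeries.map (C : A →+* A[X]) E - 1) ^ m) = 0 := by
    rw [PowerSeries.coeff_mul]
    refine Finset.sum_eq_zero fun p hp => ?_
    rw [mem_antidiagonal] at hp
    rcases Nat.eq_zero_or_pos p.1 with hp1 | hp1
    · rw [hp1, PowerSeries.coeff_C_mul, coeff_zero_riccati, mul_zero, zero_mul]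
    · rw [coeff_pow_eq_zero (by rw [map_sub, hE0']; simp) _ _ (by omega), mul_zero]
  simp only [map_add, h0, add_zero, map_sum, unitIntegral_sum] at h
  rw [riccati, coeff_wordSeries, unitIntegral_sum] at h
  refine Eq.trans (Finset.sum_congr rfl fun l _ => ?_) (h.trans
    (Finset.sum_congr rfl fun k _ => ?_))
  · have : (l.map fun b => (C (γ b) : A[X])).prod = C (l.map γ).prod := by
      rw [map_list_prod, List.map_map]
      rfl
    rw [this]
    split_ifs
    · simp [unitIntegral_zero]
    · rw [unitIntegral_aeval_mul_C]
  · have h1 : ((-X : A[X])) ^ k = aeval (X : A[X]) ((C ((-1) ^ k) * X ^ k : ℚ[X])) := by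
      rw [neg_pow, map_mul, aeval_X_pow, aeval_C, map_pow, map_neg, map_one]
    rw [PowerSeries.coeff_C_mul, ← map_one (PowerSeries.map (C : A →+* A[X])), ← map_sub,
      ← map_pow, PowerSeries.coeff_map, h1, unitIntegral_aeval_mul_C, C_mul_X_pow_eq_monomial,
      unitIntegral_monomial, smul_eq_mul, mul_comm, ← div_eq_mul_one_div]

end Logarithm

/-! ### Formal sums and exponentials -/

section FormalSums

variable {A : Type*} [Ring A]

/-- If the r-th term starts in degree r or later, finiteness is automatic and the formal sum
truncates at r = m. -/
theorem formalHasSum_iff {T : ℕ → A⟦X⟧} {S : A⟦X⟧}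
    (hT : ∀ m r, m < r → PowerSeries.coeff m (T r) = 0) :
    FormalHasSum T S ↔ ∀ m, PowerSeries.coeff m S =
      ∑ r ∈ Finset.range (m + 1), PowerSeries.coeff m (T r) := by
  have hsub : ∀ m, (Function.support fun r => PowerSeries.coeff m (T r)) ⊆
      (Finset.range (m + 1) : Finset ℕ) := by
    intro m r hr
    rw [Finset.mem_coe, Finset.mem_range]
    by_contra h
    exact hr (hT m r (by omega))
  refine forall_congr' fun m => ?_
  rw [finsum_eq_sum_of_support_subset _ (hsub m)]
  exact and_iff_right ((Finset.finite_toSet _).subset (hsub m))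

variable (K : Type*) [CommRing K] [Algebra ℚ K] [Algebra K A]

theorem isExp_iff {d E : A⟦X⟧} (hd : PowerSeries.coeff 0 d = 0) :
    IsExp K d E ↔ ∀ m, PowerSeries.coeff m E = ∑ k ∈ Finset.range (m + 1),
      algebraMap ℚ K (1 / (k.factorial : ℚ)) • PowerSeries.coeff m (d ^ k) := by
  rw [IsExp, formalHasSum_iff]
  · simp only [PowerSeries.coeff_smul]
  · intro m r hr
    rw [PowerSeries.coeff_smul, coeff_pow_eq_zero hd r m hr, smul_zero]

/-- A power series without constant term is determined by its exponential. -/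
theorem IsExp.unique {d d' E : A⟦X⟧} (hd : PowerSeries.coeff 0 d = 0)
    (hd' : PowerSeries.coeff 0 d' = 0) (h : IsExp K d E) (h' : IsExp K d' E) : d = d' := by
  rw [isExp_iff K hd] at h
  rw [isExp_iff K hd'] at h'
  ext m
  induction m using Nat.strong_induction_on with
  | _ m ih =>
    rcases Nat.eq_zero_or_pos m with rfl | hm
    · rw [hd, hd']
    · have hpow : ∀ k, (∀ j < m, PowerSeries.coeff j (d ^ (k + 1)) =
          PowerSeries.coeff j (d' ^ (k + 1))) ∧
          PowerSeries.coeff m (d ^ (k + 2)) = PowerSeries.coeff m (d' ^ (k + 2)) := by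
        -- In a product of two series without constant term, the coefficient of t^j uses only
        -- coefficients of index below j of each factor.
        have step : ∀ k j, (∀ i < m, PowerSeries.coeff i (d ^ (k + 1)) =
            PowerSeries.coeff i (d' ^ (k + 1))) → j ≤ m →
            PowerSeries.coeff j (d ^ (k + 2)) = PowerSeries.coeff j (d' ^ (k + 2)) := by
          intro k j hk hj
          rw [pow_succ d, pow_succ d', PowerSeries.coeff_mul, PowerSeries.coeff_mul]
          refine Finset.sum_congr rfl fun p hp => ?_
          rw [mem_antidiagonal] at hp
          rcases Nat.eq_zero_or_pos p.2 with h2 | h2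
          · rw [h2, hd, hd', mul_zero, mul_zero]
          · rcases Nat.eq_zero_or_pos p.1 with h1 | h1
            · rw [h1, coeff_pow_eq_zero hd _ 0 (by omega), coeff_pow_eq_zero hd' _ 0 (by omega),
                zero_mul, zero_mul]
            · rw [hk p.1 (by omega), ih p.2 (by omega)]
        have all : ∀ k, ∀ j < m, PowerSeries.coeff j (d ^ (k + 1)) =
            PowerSeries.coeff j (d' ^ (k + 1)) := by
          intro k
          induction k with
          | zero => simpa using ih
          | succ k ihk => exact fun j hj => step k j ihk hj.le
        exact fun k => ⟨all k, step k m (all k) le_rfl⟩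
      obtain ⟨m, rfl⟩ : ∃ m', m = m' + 1 := ⟨m - 1, by omega⟩
      have e := (h (m + 1)).symm.trans (h' (m + 1))
      -- With k = 0 and k = 1 split off from both exponentials, the terms with k ≥ 2 agree and
      -- cancel, leaving the linear terms.
      rw [Finset.sum_range_succ', Finset.sum_range_succ', Finset.sum_range_succ',
        Finset.sum_range_succ'] at e
      simpa [(hpow _).2] using e

end FormalSums

/-! ### Substitution into rational power series -/

section Evaluation

variable {A : Type*} [Ring A] [Algebra ℚ A]

/-- `f(y) = ∑ f_k y^k`, for `y` without constant term. -/
def evalSeries (y : A⟦X⟧) (f : ℚ⟦X⟧) : A⟦X⟧ :=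
  PowerSeries.mk fun m => ∑ k ∈ Finset.range (m + 1),
    PowerSeries.coeff k f • PowerSeries.coeff m (y ^ k)

variable {y : A⟦X⟧}

theorem coeff_evalSeries (hy : PowerSeries.coeff 0 y = 0) (f : ℚ⟦X⟧) {m N : ℕ} (h : m ≤ N) :
    PowerSeries.coeff m (evalSeries y f) = ∑ k ∈ Finset.range (N + 1),
      PowerSeries.coeff k f • PowerSeries.coeff m (y ^ k) := by
  rw [evalSeries, PowerSeries.coeff_mk]
  refine Finset.sum_subset (Finset.range_mono (by omega)) fun k _ hk => ?_
  rw [Finset.mem_range, not_lt] at hk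
  rw [coeff_pow_eq_zero hy k m (by omega), smul_zero]

theorem evalSeries_one : evalSeries y 1 = 1 := by
  ext m
  rw [evalSeries, PowerSeries.coeff_mk, Finset.sum_eq_single 0]
  · simp
  · intro k _ hk
    rw [PowerSeries.coeff_one, if_neg hk, zero_smul]
  · simp

/-- Powers of the single element y multiply as in ℚ[[x]], even though A is noncommutative. Both
sides are reduced to a sum over pairs of exponents; pairs with sum above m contribute nothing to
t^m. -/
theorem evalSeries_mul (hy : PowerSeries.coeff 0 y = 0) (f g : ℚ⟦X⟧) :
    evalSeries y (f * g) = evalSeries y f * evalSeries y g := by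
  ext m
  have hR : PowerSeries.coeff m (evalSeries y f * evalSeries y g) =
      ∑ x ∈ Finset.range (m + 1) ×ˢ Finset.range (m + 1),
        (PowerSeries.coeff x.1 f * PowerSeries.coeff x.2 g) •
          PowerSeries.coeff m (y ^ (x.1 + x.2)) := by
    have h1 : ∀ p ∈ antidiagonal m, PowerSeries.coeff p.1 (evalSeries y f) *
        PowerSeries.coeff p.2 (evalSeries y g) =
        ∑ x ∈ Finset.range (m + 1) ×ˢ Finset.range (m + 1),
          (PowerSeries.coeff x.1 f * PowerSeries.coeff x.2 g) •
            (PowerSeries.coeff p.1 (y ^ x.1) * PowerSeries.coeff p.2 (y ^ x.2)) := by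
      intro p hp
      rw [mem_antidiagonal] at hp
      rw [coeff_evalSeries hy f (by omega : p.1 ≤ m), coeff_evalSeries hy g (by omega : p.2 ≤ m),
        Finset.sum_mul_sum, Finset.sum_product]
      refine Finset.sum_congr rfl fun i _ => Finset.sum_congr rfl fun j _ => ?_
      rw [smul_mul_smul_comm]
    rw [PowerSeries.coeff_mul, Finset.sum_congr rfl h1, Finset.sum_comm]
    refine Finset.sum_congr rfl fun x _ => ?_
    rw [← Finset.smul_sum, pow_add, PowerSeries.coeff_mul]
  rw [hR, evalSeries, PowerSeries.coeff_mk]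
  simp only [PowerSeries.coeff_mul, Finset.sum_smul]
  rw [Finset.sum_sigma']
  refine Finset.sum_of_injOn (fun x => x.2) ?_ ?_ ?_ ?_
  · rintro ⟨k, x⟩ hx ⟨k', x'⟩ hx' h
    simp only [Finset.coe_sigma, Set.mem_sigma_iff, Finset.mem_coe, mem_antidiagonal] at hx hx'
    obtain rfl : x = x' := h
    rw [← hx.2, ← hx'.2]
  · rintro ⟨k, x⟩ hx
    simp only [Finset.coe_sigma, Set.mem_sigma_iff, Finset.mem_coe, mem_antidiagonal,
      Finset.mem_range] at hx
    simp only [Finset.coe_product, Set.mem_prod, Finset.mem_coe, Finset.mem_range]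
    omega
  · rintro x - hx
    rw [coeff_pow_eq_zero hy _ m, smul_zero]
    by_contra h
    refine hx ⟨⟨x.1 + x.2, x⟩, ?_, rfl⟩
    simp only [Finset.coe_sigma, Set.mem_sigma_iff, Finset.mem_coe, mem_antidiagonal,
      Finset.mem_range, and_true]
    omega
  · rintro ⟨k, x⟩ hx
    rw [Finset.mem_sigma, mem_antidiagonal] at hx
    rw [hx.2]

theorem evalSeries_pow (hy : PowerSeries.coeff 0 y = 0) (f : ℚ⟦X⟧) (k : ℕ) :
    evalSeries y (f ^ k) = evalSeries y f ^ k := by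
  induction k with
  | zero => rw [pow_zero, pow_zero, evalSeries_one]
  | succ k ih => rw [pow_succ, pow_succ, evalSeries_mul hy, ih]

/-- `exp (log (1 + x)) = 1 + x`. -/
theorem coeff_sum_log_pow (N k : ℕ) (hk : k < N) :
    ∑ j ∈ Finset.range N, (1 / (j.factorial : ℚ)) *
      PowerSeries.coeff k (PowerSeries.log ℚ ^ j) = if k ≤ 1 then 1 else 0 := by
  have hlog0 : PowerSeries.coeff 0 (PowerSeries.log ℚ) = 0 := by simp
  -- The differential equation (1 + x) · x log(1 + x)' = x.
  have hlog : (1 + PowerSeries.X) * euler (PowerSeries.log ℚ) = PowerSeries.X := by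
    ext m
    rw [add_mul, one_mul, map_add]
    rcases m with _ | _ | m
    · simp
    · rw [PowerSeries.coeff_succ_X_mul]
      simp
    · rw [PowerSeries.coeff_succ_X_mul, PowerSeries.coeff_X, if_neg (by omega)]
      simp only [coeff_euler, PowerSeries.coeff_log, Nat.add_eq_zero_iff, one_ne_zero, and_false,
        if_false, nsmul_eq_mul, eq_ratCast, Rat.cast_id]
      push_cast
      have h1 : (m : ℚ) + 1 + 1 ≠ 0 := by positivity
      have h2 : (m : ℚ) + 1 ≠ 0 := by positivity
      field_simp
      ring
  set e : ℕ → ℚ⟦X⟧ := fun N =>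
    ∑ j ∈ Finset.range N, PowerSeries.C (1 / (j.factorial : ℚ)) * PowerSeries.log ℚ ^ j with he
  have hpow : ∀ j, euler (PowerSeries.log ℚ ^ (j + 1)) =
      ((j + 1 : ℕ) : ℚ⟦X⟧) * (PowerSeries.log ℚ ^ j * euler (PowerSeries.log ℚ)) := by
    intro j
    induction j with
    | zero => simp
    | succ j ih =>
      rw [pow_succ, euler_mul, ih]
      push_cast
      ring
  -- Differentiating a truncated exponential lowers the truncation by one.
  have heul : ∀ N, euler (e (N + 1)) = e N * euler (PowerSeries.log ℚ) := by
    intro N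
    induction N with
    | zero => simp [he, euler_one]
    | succ N ih =>
      have h1 : e (N + 2) = e (N + 1) +
          PowerSeries.C (1 / ((N + 1).factorial : ℚ)) * PowerSeries.log ℚ ^ (N + 1) := by
        rw [he]
        exact Finset.sum_range_succ _ _
      have h2 : e (N + 1) = e N +
          PowerSeries.C (1 / (N.factorial : ℚ)) * PowerSeries.log ℚ ^ N := by
        rw [he]
        exact Finset.sum_range_succ _ _
      have h3 : (PowerSeries.C (1 / ((N + 1).factorial : ℚ)) : ℚ⟦X⟧) * ((N + 1 : ℕ) : ℚ⟦X⟧) =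
          PowerSeries.C (1 / (N.factorial : ℚ)) := by
        rw [← map_natCast PowerSeries.C, ← map_mul, Nat.factorial_succ]
        congr 1
        have : (N.factorial : ℚ) ≠ 0 := Nat.cast_ne_zero.2 N.factorial_ne_zero
        have : ((N : ℚ) + 1) ≠ 0 := by positivity
        push_cast
        field_simp
      rw [h1, euler_add, ih, euler_C_mul, hpow, h2, ← mul_assoc, h3]
      ring
  have hcoe : ∀ k N, PowerSeries.coeff k (e N) = ∑ j ∈ Finset.range N,
      (1 / (j.factorial : ℚ)) * PowerSeries.coeff k (PowerSeries.log ℚ ^ j) := by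
    intro k N
    simp only [he, map_sum, PowerSeries.coeff_C_mul]
  rw [← hcoe]
  obtain ⟨N, rfl⟩ : ∃ N', N = N' + 1 := ⟨N - 1, by omega⟩
  have hlast : ∀ i < N, PowerSeries.coeff i (e N) = PowerSeries.coeff i (e (N + 1)) := by
    intro i hi
    rw [hcoe, hcoe, Finset.sum_range_succ, coeff_pow_eq_zero hlog0 N i hi, mul_zero, add_zero]
  have hode : (1 + PowerSeries.X) * euler (e (N + 1)) = PowerSeries.X * e N := by
    rw [heul, mul_left_comm, hlog, mul_comm]
  -- From (1 + x) θe = x e: the factor 1 - i stops the recursion after degree 1, so only 1 + x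
  -- survives.
  have hrec : ∀ i < N, ((i : ℚ) + 1) * PowerSeries.coeff (i + 1) (e (N + 1)) =
      (1 - i) * PowerSeries.coeff i (e (N + 1)) := by
    intro i hi
    have := congrArg (PowerSeries.coeff (i + 1)) hode
    rw [PowerSeries.coeff_succ_X_mul, add_mul, one_mul, map_add, PowerSeries.coeff_succ_X_mul,
      coeff_euler, coeff_euler, hlast i hi, nsmul_eq_mul, nsmul_eq_mul] at this
    push_cast at this
    linarith
  have h0 : PowerSeries.coeff 0 (e (N + 1)) = 1 := by
    rw [hcoe, Finset.sum_range_succ', Finset.sum_eq_zero]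
    · simp
    · intro j _
      rw [coeff_pow_eq_zero hlog0 (j + 1) 0 (by omega), mul_zero]
  have main : ∀ k < N + 1, PowerSeries.coeff k (e (N + 1)) = if k ≤ 1 then 1 else 0 := by
    intro k
    induction k with
    | zero => intro _; simpa using h0
    | succ k ih =>
      intro hk
      have h := hrec k (by omega)
      rw [ih (by omega)] at h
      have hk' : (k : ℚ) + 1 ≠ 0 := by positivity
      refine mul_left_cancel₀ hk' (h.trans ?_)
      rcases k with _ | _ | k
      · simp
      · simp
      · simp
  exact main k hk

/-- The rational identity exp(log(1 + x)) = 1 + x is transported by x ↦ y, using multiplicativity of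
`evalSeries`. -/
theorem isExp_evalSeries_log (K : Type*) [CommRing K] [Algebra ℚ K] [Algebra K A]
    [IsScalarTower ℚ K A] (hy : PowerSeries.coeff 0 y = 0) :
    IsExp K (evalSeries y (PowerSeries.log ℚ)) (1 + y) := by
  have h0 : PowerSeries.coeff 0 (evalSeries y (PowerSeries.log ℚ)) = 0 := by
    rw [coeff_evalSeries hy _ le_rfl]
    simp
  rw [isExp_iff K h0]
  intro m
  have h1 : ∀ j, algebraMap ℚ K (1 / (j.factorial : ℚ)) •
      PowerSeries.coeff m (evalSeries y (PowerSeries.log ℚ) ^ j) =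
      ∑ k ∈ Finset.range (m + 1), ((1 / (j.factorial : ℚ)) *
        PowerSeries.coeff k (PowerSeries.log ℚ ^ j)) • PowerSeries.coeff m (y ^ k) := by
    intro j
    rw [algebraMap_smul, ← evalSeries_pow hy, coeff_evalSeries hy _ le_rfl, Finset.smul_sum]
    simp only [smul_smul]
  simp only [h1]
  rw [Finset.sum_comm]
  have h2 : ∀ k ∈ Finset.range (m + 1), ∑ j ∈ Finset.range (m + 1), ((1 / (j.factorial : ℚ)) *
      PowerSeries.coeff k (PowerSeries.log ℚ ^ j)) • PowerSeries.coeff m (y ^ k) =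
      if k ≤ 1 then PowerSeries.coeff m (y ^ k) else 0 := by
    intro k hk
    rw [← Finset.sum_smul, coeff_sum_log_pow _ _ (Finset.mem_range.1 hk), ite_smul, one_smul,
      zero_smul]
  rw [Finset.sum_congr rfl h2]
  rcases m with _ | m
  · simpa using hy
  · rw [Finset.sum_range_succ', Finset.sum_range_succ', Finset.sum_eq_zero]
    · simp [add_comm]
    · intro k _
      rw [if_neg (by omega)]

end Evaluation

/-! ### Coefficients of iterated integrals -/

section Integrals

variable (K : Type*) [CommRing K] [Algebra ℚ K] {R : Type*} [Ring R] [Algebra K R]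
  [Algebra ℚ R] [IsScalarTower ℚ K R]

/-- The exponents of the monomials that contribute to `t^m` in an `r`-fold integral. -/
def simplexExps (r m : ℕ) : Finset (Fin (r + 1) → ℕ) :=
  (Fintype.piFinset fun _ => Finset.range (m + 1)).filter fun e => ∑ i, e i + r = m

theorem mem_simplexExps {r m : ℕ} {e : Fin (r + 1) → ℕ} :
    e ∈ simplexExps r m ↔ ∑ i, e i + r = m := by
  rw [simplexExps, Finset.mem_filter, and_iff_right_iff_imp, Fintype.mem_piFinset]
  intro h i
  have := Finset.single_le_sum (f := e) (fun _ _ => Nat.zero_le _) (Finset.mem_univ i)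
  rw [Finset.mem_range]
  omega

/-- Every tail sum starting before the last index contains the last entry, so that entry may be
merged into its predecessor. This mirrors the substitution of t_r for the upper limit of the
innermost integral. -/
theorem simplexWeight_succ {r : ℕ} (b : Fin (r + 1) → ℕ) :
    simplexWeight b = simplexWeight (fun i : Fin r =>
      b i.castSucc + if (i : ℕ) + 1 = r then b (Fin.last r) else 0) *
        ((b (Fin.last r) : ℕ) : ℚ)⁻¹ := by
  rw [simplexWeight, Fin.prod_univ_castSucc, simplexWeight]
  congr 1
  · refine Finset.prod_congr rfl fun i _ => ?_
    congr 1
    have h1 : Finset.Ici i.castSucc =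
        insert (Fin.last r) ((Finset.Ici i).map Fin.castSuccEmb) := by
      ext x
      refine Fin.lastCases ?_ (fun x => ?_) x
      · simp [Fin.le_last]
      · simp
    have h2 : Fin.last r ∉ (Finset.Ici i).map Fin.castSuccEmb := by
      simp
    rw [h1, Finset.sum_insert h2, Finset.sum_map]
    push_cast
    rw [Finset.sum_add_distrib, add_comm]
    congr 1
    have hr : r - 1 < r := by have := i.2; omega
    rw [Finset.sum_eq_single (⟨r - 1, hr⟩ : Fin r)]
    · rw [if_pos (by simp; omega)]
    · intro j _ hj
      rw [if_neg]
      intro h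
      exact hj (Fin.ext (by simp; omega))
    · intro h
      refine absurd (Finset.mem_Ici.2 ?_) h
      rw [Fin.le_def]
      have := i.2
      simp
      omega
  · congr 1
    have : Finset.Ici (Fin.last r) = {Fin.last r} := by
      ext x
      simp [Fin.last_le_iff]
    rw [this, Finset.sum_singleton]

/-- A pair p records how the exponent of t_r splits: p.1 was there before, p.2 comes from the
integrated variable, whose exponent was p.2 - 1 before integration. -/
theorem coeff_substLast_antideriv {r : ℕ} (f : MvPowerSeries (Fin (r + 2)) R)
    (e : Fin (r + 1) → ℕ) :
    MvPowerSeries.coeff (Finsupp.equivFunOnFinite.symm e)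
        (substLast (antideriv K (Fin.last (r + 1)) f)) =
      ∑ p ∈ antidiagonal (e (Fin.last r)), if p.2 = 0 then 0 else
        (1 / (p.2 : ℚ)) • MvPowerSeries.coeff (Finsupp.equivFunOnFinite.symm
          (Fin.snoc (Function.update e (Fin.last r) p.1) (p.2 - 1) : Fin (r + 2) → ℕ)) f := by
  change (∑ p ∈ antidiagonal (e (Fin.last r)), MvPowerSeries.coeff (Finsupp.equivFunOnFinite.symm
    (Fin.snoc (Function.update e (Fin.last r) p.1) p.2 : Fin (r + 2) → ℕ))
      (antideriv K (Fin.last (r + 1)) f)) = _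
  refine Finset.sum_congr rfl fun p _ => ?_
  have hs : ∀ x : ℕ, (Finsupp.equivFunOnFinite.symm (Fin.snoc
      (Function.update e (Fin.last r) p.1) x : Fin (r + 2) → ℕ)) (Fin.last (r + 1)) = x := by
    intro x
    exact Fin.snoc_last (α := fun _ => ℕ) x (Function.update e (Fin.last r) p.1)
  change (if (Finsupp.equivFunOnFinite.symm (Fin.snoc
      (Function.update e (Fin.last r) p.1) p.2 : Fin (r + 2) → ℕ)) (Fin.last (r + 1)) = 0 then
      (0 : R) else algebraMap ℚ K (1 / (((Finsupp.equivFunOnFinite.symm (Fin.snoc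
      (Function.update e (Fin.last r) p.1) p.2 : Fin (r + 2) → ℕ)) (Fin.last (r + 1)) : ℕ) : ℚ)) •
      MvPowerSeries.coeff (Finsupp.equivFunOnFinite.symm (Fin.snoc
        (Function.update e (Fin.last r) p.1) p.2 : Fin (r + 2) → ℕ) -
          Finsupp.single (Fin.last (r + 1)) 1) f) = _
  have hexp : Finsupp.equivFunOnFinite.symm (Fin.snoc
      (Function.update e (Fin.last r) p.1) p.2 : Fin (r + 2) → ℕ) -
      Finsupp.single (Fin.last (r + 1)) 1 = Finsupp.equivFunOnFinite.symm
        (Fin.snoc (Function.update e (Fin.last r) p.1) (p.2 - 1) : Fin (r + 2) → ℕ) := by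
    refine Finsupp.ext fun i => ?_
    rw [Finsupp.tsub_apply, Finsupp.equivFunOnFinite_symm_apply_apply,
      Finsupp.equivFunOnFinite_symm_apply_apply]
    refine Fin.lastCases ?_ (fun i => ?_) i
    · rw [Fin.snoc_last, Fin.snoc_last, Finsupp.single_eq_same]
    · rw [Fin.snoc_castSucc, Fin.snoc_castSucc,
        Finsupp.single_eq_of_ne (Fin.castSucc_ne_last i), Nat.sub_zero]
  rw [hs, algebraMap_smul, hexp]

/-- Each integration raises the degree by one and divides by the exponent accumulated so far from
the inside, which makes the denominators the tail sums of the e_i + 1. -/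
theorem coeff_simplexIntegral (r m : ℕ) : ∀ f : MvPowerSeries (Fin (r + 1)) R,
    PowerSeries.coeff m (simplexIntegral K r f) = ∑ e ∈ simplexExps r m,
      simplexWeight (fun i : Fin r => e i.succ + 1) •
        MvPowerSeries.coeff (Finsupp.equivFunOnFinite.symm e) f := by
  induction r with
  | zero =>
    intro f
    have h : simplexExps 0 m = {fun _ => m} := by
      ext e
      rw [mem_simplexExps, Finset.mem_singleton]
      simp [funext_iff, Fin.forall_fin_one]
    have h' : (Finsupp.equivFunOnFinite.symm fun _ : Fin 1 => m) = Finsupp.single 0 m := by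
      refine Finsupp.ext fun i => ?_
      obtain rfl := Subsingleton.elim i 0
      simp
    rw [h, Finset.sum_singleton, h', simplexIntegral, PowerSeries.coeff_mk]
    simp [simplexWeight]
  | succ r ih =>
    intro f
    rw [simplexIntegral, ih]
    simp only [coeff_substLast_antideriv, Finset.smul_sum]
    rw [Finset.sum_sigma']
    symm
    -- The exponent of the last variable, raised by one, is added to the exponent before it; the
    -- pair remembers the split.
    refine Finset.sum_of_injOn (fun e => ⟨Function.update (Fin.init e : Fin (r + 1) → ℕ)
      (Fin.last r) (e (Fin.last r).castSucc + (e (Fin.last (r + 1)) + 1)),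
      (e (Fin.last r).castSucc, e (Fin.last (r + 1)) + 1)⟩) ?_ ?_ ?_ ?_
    · intro e _ e' _ h
      simp only [Sigma.mk.injEq, heq_eq_eq, Prod.mk.injEq] at h
      obtain ⟨h1, h2, h3⟩ := h
      funext i
      refine Fin.lastCases ?_ (fun i => ?_) i
      · omega
      · refine Fin.lastCases h2 (fun i => ?_) i
        have := congrFun h1 i.castSucc
        simpa [Fin.castSucc_ne_last, Fin.init] using this
    · intro e he
      rw [Finset.mem_coe, mem_simplexExps, Fin.sum_univ_castSucc, Fin.sum_univ_castSucc] at he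
      rw [Finset.mem_coe, Finset.mem_sigma, mem_simplexExps, mem_antidiagonal,
        Fin.sum_univ_castSucc]
      simp only [Function.update_self, ne_eq, Fin.castSucc_ne_last, not_false_eq_true,
        Function.update_of_ne, Fin.init, and_true]
      omega
    · rintro ⟨e, p⟩ hx hn
      rw [Finset.mem_sigma, mem_simplexExps, mem_antidiagonal] at hx
      simp only at hx
      rcases Nat.eq_zero_or_pos p.2 with h0 | h0
      · simp [h0]
      · refine absurd ⟨Fin.snoc (Function.update e (Fin.last r) p.1) (p.2 - 1), ?_, ?_⟩ hn
        · rw [Finset.mem_coe, mem_simplexExps, Fin.sum_univ_castSucc, Fin.sum_univ_castSucc]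
          rw [Fin.sum_univ_castSucc] at hx
          simp only [Fin.snoc_castSucc, Function.update_self, ne_eq, Fin.castSucc_ne_last,
            not_false_eq_true, Function.update_of_ne, Fin.snoc_last]
          omega
        · have h1 : p.2 - 1 + 1 = p.2 := by omega
          simp only [Fin.snoc_castSucc, Function.update_self, Fin.snoc_last, Fin.init_snoc, h1,
            hx.2, Function.update_idem, Function.update_eq_self, Prod.mk.eta]
    · intro e _
      have h1 : e (Fin.last (r + 1)) + 1 ≠ 0 := by omega
      simp only [h1, if_false, Nat.add_sub_cancel, Function.update_idem]
      have h2 : (Fin.snoc (Function.update (Fin.init e : Fin (r + 1) → ℕ) (Fin.last r)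
          (e (Fin.last r).castSucc)) (e (Fin.last (r + 1))) : Fin (r + 2) → ℕ) = e := by
        have : (Function.update (Fin.init e : Fin (r + 1) → ℕ) (Fin.last r)
            (e (Fin.last r).castSucc)) = Fin.init e := Function.update_eq_self _ _
        rw [this]
        exact Fin.snoc_init_self e
      rw [h2, smul_smul, simplexWeight_succ]
      congr 1
      rw [one_div]
      congr 1
      congr 1
      funext i
      by_cases hi : (i : ℕ) + 1 = r
      · have : i.succ = Fin.last r := Fin.ext (by simpa using hi)
        rw [if_pos hi, this, Function.update_self, Fin.succ_castSucc, this, Fin.succ_last]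
        ring
      · have : i.succ ≠ Fin.last r := fun h => hi (by simpa using congrArg Fin.val h)
        rw [if_neg hi, Function.update_of_ne this, Fin.succ_castSucc]
        rfl

end Integrals

/-! ### Coefficients of ordered products -/

section OrderedProduct

variable {R : Type*} [Ring R]

/-- The variables in the list are distinct, so the exponent vector leaves only one way to distribute
itself over the factors. -/
theorem coeff_prod_inVar {σ : Type*} (h : R⟦X⟧) (l : List σ) :
    ∀ e : σ →₀ ℕ, l.Nodup → MvPowerSeries.coeff e (l.map fun i => inVar i h).prod =
      open Classical in if ∀ i, e i ≠ 0 → i ∈ l then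
        (l.map fun i => PowerSeries.coeff (e i) h).prod else 0 := by
  classical
  induction l with
  | nil =>
    intro e _
    rw [List.map_nil, List.prod_nil, MvPowerSeries.coeff_one]
    refine if_congr ?_ rfl rfl
    simp [Finsupp.ext_iff]
  | cons i l ih =>
    intro e hl
    rw [List.nodup_cons] at hl
    have hc : ∀ x : σ →₀ ℕ, MvPowerSeries.coeff x (inVar i h) =
        if x = Finsupp.single i (x i) then PowerSeries.coeff (x i) h else 0 := by
      intro x
      change (if x = Finsupp.single i (x i) then PowerSeries.coeff (x i) h else 0) = _
      congr
    rw [List.map_cons, List.prod_cons, MvPowerSeries.coeff_mul,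
      Finset.sum_eq_single (Finsupp.single i (e i), e.erase i)]
    · rw [hc, Finsupp.single_eq_same, if_pos rfl, ih _ hl.2, mul_ite, mul_zero, List.map_cons,
        List.prod_cons]
      have h1 : (l.map fun j => PowerSeries.coeff (e.erase i j) h) =
          l.map fun j => PowerSeries.coeff (e j) h := by
        refine List.map_congr_left fun j hj => ?_
        rw [Finsupp.erase_ne (by rintro rfl; exact hl.1 hj)]
      rw [h1]
      refine if_congr ?_ rfl rfl
      refine forall_congr' fun j => ?_
      by_cases hj : j = i
      · simp [hj]
      · simp [Finsupp.erase_ne hj, hj]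
    · rintro ⟨x, y⟩ hxy hne
      rw [mem_antidiagonal] at hxy
      rw [hc, ih _ hl.2]
      split_ifs with h1 h2
      · refine absurd ?_ hne
        have hy : y i = 0 := by
          by_contra hy
          exact hl.1 (h2 i hy)
        have hx : x i = e i := by
          rw [← hxy, Finsupp.add_apply, hy, add_zero]
        rw [hx] at h1
        simp only at hxy
        rw [Prod.mk.injEq]
        refine ⟨h1, ?_⟩
        ext j
        by_cases hj : j = i
        · rw [hj, hy, Finsupp.erase_same]
        · rw [Finsupp.erase_ne hj, ← hxy, Finsupp.add_apply, show x = _ from h1,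
            Finsupp.single_eq_of_ne hj,
            zero_add]
      · rw [mul_zero]
      · rw [zero_mul]
      · rw [zero_mul]
    · intro hn
      exact absurd (mem_antidiagonal.2 (Finsupp.single_add_erase i e)) hn

theorem mvCoeff_smul {K : Type*} [CommRing K] [Algebra K R] {σ : Type*} (k : K)
    (f : MvPowerSeries σ R) (e : σ →₀ ℕ) :
    MvPowerSeries.coeff e (k • f) = k • MvPowerSeries.coeff e f := rfl

theorem coeff_orderedProduct {r : ℕ} (h : R⟦X⟧) (s : Equiv.Perm (Fin r)) (e : Fin (r + 1) → ℕ) :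
    MvPowerSeries.coeff (Finsupp.equivFunOnFinite.symm e) (orderedProduct h s) =
      if e 0 = 0 then
        (List.ofFn fun j : Fin r => PowerSeries.coeff (e (s j.rev).succ) h).prod else 0 := by
  have h1 : orderedProduct h s =
      ((List.ofFn fun j : Fin r => (s j.rev).succ).map fun i => inVar i h).prod := by
    rw [List.map_ofFn]
    rfl
  have h2 : (∀ i, (Finsupp.equivFunOnFinite.symm e) i ≠ 0 →
      i ∈ List.ofFn fun j : Fin r => (s j.rev).succ) ↔ e 0 = 0 := by
    simp only [Finsupp.equivFunOnFinite_symm_apply_apply, List.mem_ofFn]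
    constructor
    · intro h
      by_contra h0
      obtain ⟨j, hj⟩ := h 0 h0
      exact Fin.succ_ne_zero _ hj
    · intro h i
      refine Fin.cases (fun h' => absurd h h') (fun i _ => ?_) i
      exact ⟨(s.symm i).rev, by simp⟩
  rw [h1, coeff_prod_inVar, List.map_ofFn]
  · by_cases h0 : e 0 = 0
    · rw [if_pos (h2.2 h0), if_pos h0]
      rfl
    · rw [if_neg (mt h2.1 h0), if_neg h0]
  · refine List.nodup_ofFn.2 fun j j' hj => ?_
    simpa using hj

end OrderedProduct

/-! ### Simplex integrals of ordered products as sums over words -/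

section BCH

variable (K : Type*) [CommRing K] [Algebra ℚ K] {R : Type*} [Ring R] [Algebra K R]
  [Algebra ℚ R] [IsScalarTower ℚ K R]

theorem sum_compWords_length {M : Type*} [AddCommMonoid M] (m r : ℕ) (g : List ℕ → M) :
    ∑ l ∈ compWords m with l.length = r, g l =
      ∑ a ∈ (Fintype.piFinset fun _ : Fin r => Finset.range (m + 1)) with
        (∀ i, 0 < a i) ∧ ∑ i, a i = m, g (List.ofFn a) := by
  symm
  refine Finset.sum_bij (fun a _ => List.ofFn a) ?_ ?_ ?_ fun _ _ => rfl
  · intro a ha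
    obtain ⟨-, h1, h2⟩ := Finset.mem_filter.1 ha
    rw [Finset.mem_filter, mem_compWords, List.length_ofFn, List.sum_ofFn]
    refine ⟨⟨fun b hb => ?_, h2⟩, rfl⟩
    obtain ⟨i, rfl⟩ := List.mem_ofFn.1 hb
    exact h1 i
  · intro a _ a' _ h
    exact List.ofFn_injective h
  · intro l hl
    rw [Finset.mem_filter, mem_compWords] at hl
    obtain ⟨⟨h1, h2⟩, rfl⟩ := hl
    refine ⟨l.get, ?_, List.ofFn_get l⟩
    have hs : ∑ i, l.get i = m := by
      rw [← List.sum_ofFn, List.ofFn_get, h2]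
    rw [Finset.mem_filter, Fintype.mem_piFinset]
    refine ⟨fun i => ?_, fun i => h1 _ (List.get_mem l i), hs⟩
    have := Finset.single_le_sum (f := l.get) (fun _ _ => Nat.zero_le _) (Finset.mem_univ i)
    rw [Finset.mem_range]
    omega

/-- A letter b stands for the monomial t_i^(b-1) of h(t_i), the shift being absorbed by the factor t
in t h. Then `wordPoly_ofFn`, integrated over the unit interval, gives the simplex weight times the
descent weight for each permutation. -/
theorem coeff_bchTerm (h : R⟦X⟧) {r : ℕ} (hr : 0 < r) (m : ℕ) :
    PowerSeries.coeff m (bchTerm K h r) = ∑ l ∈ compWords m with l.length = r,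
      unitIntegral (wordPoly l) •
        (l.map fun b => PowerSeries.coeff b (PowerSeries.X * h)).prod := by
  rw [bchTerm, coeff_simplexIntegral, sum_compWords_length]
  have h1 : ∀ a : Fin r → ℕ, unitIntegral (wordPoly (List.ofFn a)) =
      ∑ s : Equiv.Perm (Fin r), simplexWeight (fun i => a (s.symm i).rev) * descentWeight s := by
    intro a
    rw [wordPoly_ofFn, unitIntegral_sum]
    exact Finset.sum_congr rfl fun s _ => by rw [unitIntegral_C_mul, unitIntegral_descent hr]
  simp only [h1, map_sum, Finset.smul_sum, Finset.sum_smul]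
  rw [Finset.sum_comm]
  conv_rhs => rw [Finset.sum_comm]
  refine Finset.sum_congr rfl fun s _ => ?_
  symm
  -- The variable t_0 = t does not occur in the product and gets exponent 0; t_{i+1} gets the letter
  -- at its position in the product, minus one.
  refine Finset.sum_of_injOn (fun a => (Fin.cons 0 fun i => a (s.symm i).rev - 1 :
    Fin (r + 1) → ℕ)) ?_ ?_ ?_ ?_
  · intro a ha a' ha' hc
    obtain ⟨-, hp, -⟩ := Finset.mem_filter.1 (Finset.mem_coe.1 ha)
    obtain ⟨-, hp', -⟩ := Finset.mem_filter.1 (Finset.mem_coe.1 ha')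
    funext j
    have := congrFun hc (s j.rev).succ
    simp only [Fin.cons_succ, Equiv.symm_apply_apply, Fin.rev_rev] at this
    have h1 := hp j
    have h2 := hp' j
    omega
  · intro a ha
    obtain ⟨-, hp, hs⟩ := Finset.mem_filter.1 (Finset.mem_coe.1 ha)
    rw [Finset.mem_coe, mem_simplexExps, Fin.sum_univ_succ]
    simp only [Fin.cons_zero, Fin.cons_succ, zero_add]
    have h1 : ∑ i, (a (s.symm i).rev - 1) = ∑ j, (a j - 1) :=
      (s.symm.trans Fin.revPerm).sum_comp fun j => a j - 1
    have h2 : ∑ j, (a j - 1) + r = m := by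
      have h3 : ∑ j, (a j - 1) + ∑ _j : Fin r, 1 = ∑ j, a j := by
        rw [← Finset.sum_add_distrib]
        exact Finset.sum_congr rfl fun j _ => Nat.sub_add_cancel (hp j)
      rw [← hs, ← h3]
      simp
    rw [h1, h2]
  · intro e he hn
    rw [mem_simplexExps] at he
    rw [mvCoeff_smul, coeff_orderedProduct, if_neg, smul_zero, smul_zero]
    intro h0
    refine hn ⟨fun j => e (s j.rev).succ + 1, ?_, ?_⟩
    · rw [Finset.mem_coe, Finset.mem_filter, Fintype.mem_piFinset]
      rw [Fin.sum_univ_succ, h0, zero_add] at he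
      have h1 : ∑ j : Fin r, e (s j.rev).succ = ∑ i : Fin r, e i.succ :=
        (Fin.revPerm.trans s).sum_comp fun i => e i.succ
      have h2 : ∑ j : Fin r, (e (s j.rev).succ + 1) = m := by
        rw [Finset.sum_add_distrib, h1]
        simpa using he
      refine ⟨fun j => ?_, fun j => Nat.succ_pos _, h2⟩
      have := Finset.single_le_sum (f := fun j : Fin r => e (s j.rev).succ + 1)
        (fun _ _ => Nat.zero_le _) (Finset.mem_univ j)
      rw [Finset.mem_range]
      omega
    · funext i
      refine Fin.cases (by simp [h0]) (fun i => by simp) i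
  · intro a ha
    obtain ⟨-, hp, -⟩ := Finset.mem_filter.1 ha
    rw [mvCoeff_smul, coeff_orderedProduct, Fin.cons_zero, if_pos rfl,
      algebraMap_smul, smul_smul, List.map_ofFn]
    simp only [Fin.cons_succ, Equiv.symm_apply_apply, Fin.rev_rev]
    congr 1
    · congr 2
      funext i
      exact (Nat.sub_add_cancel (hp _)).symm
    · congr 2
      funext j
      obtain ⟨k, hk⟩ : ∃ k, a j = k + 1 := ⟨a j - 1, (Nat.sub_add_cancel (hp j)).symm⟩
      rw [Function.comp_apply, hk, PowerSeries.coeff_succ_X_mul, Nat.add_sub_cancel]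

end BCH

/-- The continuous Baker–Campbell–Hausdorff formula: if `E' = E h` and `E(0) = 1`, then the sum of
the terms `bchTerm` is a logarithm of `E`. -/
theorem exists_isExp_bchTerm (K : Type*) [CommRing K] [Algebra ℚ K] {R : Type*} [Ring R]
    [Algebra K R] (h E : R⟦X⟧) (hE0 : PowerSeries.coeff 0 E = 1)
    (hE : euler E = E * (PowerSeries.X * h)) (S : Subalgebra K R)
    (hS : ∀ m, PowerSeries.coeff m h ∈ S) :
    ∃ d : R⟦X⟧, PowerSeries.coeff 0 d = 0 ∧ IsExp K d E ∧ (∀ m, PowerSeries.coeff m d ∈ S) ∧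
      FormalHasSum (fun r => bchTerm K h (r + 1)) d := by
  -- The rational structure is pulled back through K, so that the two scalar actions are compatible.
  let _ : Algebra ℚ R := Algebra.compHom R (algebraMap ℚ K)
  have _ : IsScalarTower ℚ K R := IsScalarTower.of_algebraMap_eq' rfl
  have hy : PowerSeries.coeff 0 (E - 1) = 0 := by
    rw [map_sub, hE0]
    simp
  set γ : ℕ → R := fun b => PowerSeries.coeff b (PowerSeries.X * h) with hγ
  have hγ0 : γ 0 = 0 := by simp [hγ]
  have hmk : PowerSeries.mk γ = PowerSeries.X * h := by
    ext b
    rw [PowerSeries.coeff_mk]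
  set d := evalSeries (E - 1) (PowerSeries.log ℚ) with hd
  have hcoeff : ∀ m, PowerSeries.coeff m d = ∑ l ∈ compWords m,
      (if l = [] then 0 else unitIntegral (wordPoly l)) • (l.map γ).prod := by
    intro m
    rw [sum_wordPoly_eq_log γ hγ0 E hE0 (by rw [hmk, hE]), hd, evalSeries, PowerSeries.coeff_mk,
      Finset.sum_range_succ']
    simp only [PowerSeries.coeff_log, Nat.add_eq_zero_iff, one_ne_zero, and_false, if_false,
      if_true, zero_smul, add_zero]
    refine Finset.sum_congr rfl fun k _ => ?_
    congr 1
    rw [pow_succ, pow_succ]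
    simp
  have hlen : ∀ m r, m < r + 1 → PowerSeries.coeff m (bchTerm K h (r + 1)) = 0 := by
    intro m r hr
    rw [coeff_bchTerm K h r.succ_pos]
    refine Finset.sum_eq_zero fun l hl => ?_
    rw [Finset.mem_filter, mem_compWords] at hl
    obtain ⟨⟨h1, h2⟩, h3⟩ := hl
    have := List.length_le_sum_of_one_le l fun b hb => h1 b hb
    omega
  refine ⟨d, ?_, ?_, ?_, ?_⟩
  · rw [hd, coeff_evalSeries hy _ le_rfl]
    simp
  · have := isExp_evalSeries_log K hy
    rwa [add_sub_cancel] at this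
  · intro m
    rw [hcoeff]
    refine sum_mem fun l _ => ?_
    rw [← algebraMap_smul K]
    refine S.smul_mem (list_prod_mem fun x hx => ?_) _
    obtain ⟨b, -, rfl⟩ := List.mem_map.1 hx
    rcases b with _ | b
    · rw [hγ0]
      exact S.zero_mem
    · rw [hγ]
      simp only [PowerSeries.coeff_succ_X_mul]
      exact hS b
  · rw [formalHasSum_iff fun m r hr => hlen m r (by omega)]
    intro m
    -- Words are grouped by length, which is at most their sum m. The class of length 0 is split off
    -- and contributes nothing; the index r stands for length r + 1.
    rw [hcoeff, ← Finset.sum_fiberwise_of_maps_to (t := Finset.range (m + 2))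
      (g := List.length), Finset.sum_range_succ',
      Finset.sum_eq_zero (s := (compWords m).filter fun l => l.length = 0), add_zero]
    · refine Finset.sum_congr rfl fun r _ => ?_
      rw [coeff_bchTerm K h r.succ_pos]
      refine Finset.sum_congr rfl fun l hl => ?_
      rw [if_neg]
      rintro rfl
      simpa using (Finset.mem_filter.1 hl).2
    · intro l hl
      rw [if_pos (List.length_eq_zero_iff.1 (Finset.mem_filter.1 hl).2), zero_smul]
    · intro l hl
      obtain ⟨h1, h2⟩ := mem_compWords.1 hl
      have := List.length_le_sum_of_one_le l fun b hb => h1 b hb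
      rw [Finset.mem_range]
      omega

/-! ### Monomials -/

namespace Mon

theorem deg_add (c : VarKind) {n : ℕ} (a b : Mon c n) : deg c (a + b) = deg c a + deg c b := by
  cases c
  · exact Finset.sum_add_distrib
  · exact List.length_append

theorem deg_var (c : VarKind) {n : ℕ} (i : Fin n) : deg c (var c i) = 1 := by
  cases c
  · change ∑ j, (Finsupp.single i 1 : Fin n →₀ ℕ) j = 1
    rw [Finset.sum_eq_single i]
    · simp
    · intro j _ hj
      exact Finsupp.single_eq_of_ne hj
    · simp
  · rfl

theorem exists_eq_var_add (c : VarKind) {n : ℕ} (w : Mon c n) (hw : w ≠ 0) :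
    ∃ i w', w = var c i + w' := by
  cases c
  · change Fin n →₀ ℕ at w
    obtain ⟨i, hi⟩ := Finsupp.ne_iff.1 (show w ≠ (0 : Fin n →₀ ℕ) from hw)
    refine ⟨i, (w - Finsupp.single i 1 : Fin n →₀ ℕ), ?_⟩
    change w = (show Fin n →₀ ℕ from Finsupp.single i 1) + (w - Finsupp.single i 1 : Fin n →₀ ℕ)
    refine (add_tsub_cancel_of_le (Finsupp.single_le_iff.2 ?_)).symm
    exact Nat.pos_of_ne_zero hi
  · change FreeAddMonoid (Fin n) at w
    induction w using FreeAddMonoid.casesOn with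
    | zero => exact absurd rfl hw
    | of_add i w => exact ⟨i, w, rfl⟩

theorem var_add_left_cancel (c : VarKind) {n : ℕ} (i : Fin n) {a b : Mon c n}
    (h : var c i + a = var c i + b) : a = b := by
  cases c
  · change Fin n →₀ ℕ at a b
    exact add_left_cancel (a := (Finsupp.single i 1 : Fin n →₀ ℕ)) h
  · exact (List.cons_inj_right i).1 h

theorem var_add_inj_free {n : ℕ} {i j : Fin n} {a b : Mon .free n}
    (h : var .free i + a = var .free j + b) : i = j ∧ a = b :=
  List.cons_eq_cons.1 h

theorem deg_zero (c : VarKind) {n : ℕ} : deg c (0 : Mon c n) = 0 := by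
  have := deg_add c (0 : Mon c n) 0
  rw [add_zero] at this
  omega

theorem var_add_ne_zero (c : VarKind) {n : ℕ} (i : Fin n) (w : Mon c n) : var c i + w ≠ 0 := by
  intro h
  have := congrArg (deg c) h
  rw [deg_add, deg_var, deg_zero] at this
  omega

theorem eq_zero_of_deg (c : VarKind) {n : ℕ} {w : Mon c n} (h : deg c w = 0) : w = 0 := by
  by_contra hw
  obtain ⟨i, w', rfl⟩ := exists_eq_var_add c w hw
  rw [deg_add, deg_var] at h
  omega

end Mon

/-! ### The order filtration -/

namespace Series

variable {c : VarKind} {n : ℕ} {R : Type*} [CommRing R]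

theorem coeff_X_mul_add (i : Fin n) (f : Series c n R) (w : Mon c n) :
    (X i * f).coeff (Mon.var c i + w) = f.coeff w := by
  rw [coeff_mul, Finset.sum_eq_single (Mon.var c i, w)]
  · simp [X]
  · rintro ⟨a, b⟩ hab hne
    rw [mem_antidiagonal] at hab
    have : a ≠ Mon.var c i := by
      rintro rfl
      exact hne (Prod.ext rfl (Mon.var_add_left_cancel c i hab))
    simp [X, this]
  · intro h
    exact absurd (mem_antidiagonal.2 rfl) h

theorem coeff_X_mul_of_forall_ne (i : Fin n) (f : Series c n R) (w : Mon c n)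
    (h : ∀ w', w ≠ Mon.var c i + w') : (X i * f).coeff w = 0 := by
  rw [coeff_mul]
  refine Finset.sum_eq_zero fun p hp => ?_
  rw [mem_antidiagonal] at hp
  have : p.1 ≠ Mon.var c i := by
    intro h'
    exact h p.2 (by rw [← h', hp])
  simp [X, this]

theorem coeff_algebraMap (r : R) (w : Mon c n) :
    (algebraMap R (Series c n R) r).coeff w = if w = 0 then r else 0 := by
  rw [Algebra.algebraMap_eq_smul_one, coeff_smul, coeff_one]
  simp

theorem coeff_sum {ι : Type*} (s : Finset ι) (f : ι → Series c n R) (w : Mon c n) :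
    (∑ i ∈ s, f i).coeff w = ∑ i ∈ s, (f i).coeff w :=
  map_sum (⟨⟨fun f : Series c n R => f.coeff w, rfl⟩, fun _ _ => rfl⟩ : Series c n R →+ R) f s

theorem orderGE_zero_left (f : Series c n R) : OrderGE 0 f :=
  fun _ h => absurd h (Nat.not_lt_zero _)

theorem OrderGE.mono {j k : ℕ} (h : j ≤ k) {f : Series c n R} (hf : OrderGE k f) : OrderGE j f :=
  fun w hw => hf w (hw.trans_le h)

theorem OrderGE.add {k : ℕ} {f g : Series c n R} (hf : OrderGE k f) (hg : OrderGE k g) :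
    OrderGE k (f + g) := fun w hw => by rw [coeff_add, hf w hw, hg w hw, add_zero]

theorem OrderGE.sub {k : ℕ} {f g : Series c n R} (hf : OrderGE k f) (hg : OrderGE k g) :
    OrderGE k (f - g) := fun w hw => by rw [coeff_sub, hf w hw, hg w hw, sub_zero]

theorem OrderGE.sum {ι : Type*} {s : Finset ι} {k : ℕ} {f : ι → Series c n R}
    (hf : ∀ i ∈ s, OrderGE k (f i)) : OrderGE k (∑ i ∈ s, f i) := fun w hw => by
  rw [coeff_sum]
  exact Finset.sum_eq_zero fun i hi => hf i hi w hw

theorem OrderGE.mul {j k : ℕ} {f g : Series c n R} (hf : OrderGE j f) (hg : OrderGE k g) :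
    OrderGE (j + k) (f * g) := fun w hw => by
  rw [coeff_mul]
  refine Finset.sum_eq_zero fun p hp => ?_
  rw [mem_antidiagonal] at hp
  rw [← hp, Mon.deg_add] at hw
  rcases lt_or_ge (Mon.deg c p.1) j with h | h
  · rw [hf _ h, zero_mul]
  · rw [hg _ (by omega), mul_zero]

theorem orderGE_X (i : Fin n) : OrderGE 1 (X i : Series c n R) := fun w hw => by
  have : w ≠ Mon.var c i := by
    rintro rfl
    rw [Mon.deg_var] at hw
    omega
  simp [X, this]

theorem eq_zero_of_orderGE {f : Series c n R} (h : ∀ k, OrderGE k f) : f = 0 := by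
  ext w
  exact h (Mon.deg c w + 1) w (Nat.lt_succ_self _)

/-- Every series is a constant plus a combination of multiples of the variables. -/
theorem exists_eq_sum_X_mul (f : Series c n R) : ∃ g : Fin n → Series c n R,
    f = algebraMap R _ (f.coeff 0) + ∑ i, X i * g i ∧
      ∀ k, OrderGE (k + 1) f → ∀ i, OrderGE k (g i) := by
  classical
  -- A commutative monomial may be divisible by several variables, so one of them is chosen for each
  -- nonconstant monomial.
  have hex : ∀ w : Mon c n, ∃ i : Option (Fin n), w ≠ 0 →
      ∃ j w', i = some j ∧ w = Mon.var c j + w' := by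
    intro w
    by_cases hw : w = 0
    · exact ⟨none, fun h => absurd hw h⟩
    · obtain ⟨i, w', h⟩ := Mon.exists_eq_var_add c w hw
      exact ⟨some i, fun _ => ⟨i, w', rfl, h⟩⟩
  choose head hhead using hex
  refine ⟨fun i => ⟨fun w => if head (Mon.var c i + w) = some i then f.coeff (Mon.var c i + w)
    else 0⟩, ?_, ?_⟩
  · ext w
    rw [coeff_add, coeff_algebraMap, coeff_sum]
    by_cases hw : w = 0
    · subst hw
      rw [if_pos rfl, Finset.sum_eq_zero, add_zero]
      intro i _
      exact coeff_X_mul_of_forall_ne i _ _ fun w' h => Mon.var_add_ne_zero c i w' h.symm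
    · obtain ⟨i, w', hi, rfl⟩ := hhead w hw
      rw [if_neg hw, zero_add, Finset.sum_eq_single i]
      · rw [coeff_X_mul_add]
        simp only [hi, if_true]
      · intro j _ hj
        by_cases h : ∃ w'', Mon.var c i + w' = Mon.var c j + w''
        · obtain ⟨w'', h⟩ := h
          rw [h, coeff_X_mul_add]
          simp only [← h, hi, Option.some.injEq, hj.symm, if_false]
        · exact coeff_X_mul_of_forall_ne j _ _ (not_exists.1 h)
      · simp
  · intro k hf i w hw
    change (if _ then _ else _) = _
    rw [hf, ite_self]
    rw [Mon.deg_add, Mon.deg_var]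
    omega

/-- An additive map which kills constants and turns multiplication by each `z_i` into
multiplication by a series without constant term is zero. -/
theorem eq_zero_of_map_X_mul {R' : Type*} [CommRing R'] (Ψ : Series c n R → Series c n R')
    (hadd : ∀ f g, Ψ (f + g) = Ψ f + Ψ g) (hconst : ∀ r, Ψ (algebraMap R _ r) = 0)
    (a : Fin n → Series c n R') (ha : ∀ i, OrderGE 1 (a i))
    (hX : ∀ i f, Ψ (X i * f) = a i * Ψ f) (f : Series c n R) : Ψ f = 0 := by
  -- Splitting off one variable raises the known order of Ψ f by one, so Ψ f lies in every step of
  -- the filtration. This replaces a continuity argument.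
  refine eq_zero_of_orderGE fun k => ?_
  induction k generalizing f with
  | zero => exact orderGE_zero_left _
  | succ k ih =>
    obtain ⟨g, hg, -⟩ := exists_eq_sum_X_mul f
    have hsum : Ψ (∑ i, X i * g i) = ∑ i, Ψ (X i * g i) :=
      map_sum (AddMonoidHom.mk' Ψ hadd) _ _
    rw [hg, hadd, hconst, zero_add, hsum]
    refine OrderGE.sum fun i _ => ?_
    rw [hX, add_comm k]
    exact (ha i).mul (ih _)

/-- An algebra homomorphism preserves the order filtration if it maps variables to series without
constant term. -/
theorem OrderGE.map (G : Series c n R →ₐ[R] Series c n R) (hG : ∀ i, OrderGE 1 (G (X i)))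
    {k : ℕ} {f : Series c n R} (hf : OrderGE k f) : OrderGE k (G f) := by
  induction k generalizing f with
  | zero => exact orderGE_zero_left _
  | succ k ih =>
    obtain ⟨g, hg, hk⟩ := exists_eq_sum_X_mul f
    have h0 : f.coeff 0 = 0 := hf 0 (by rw [Mon.deg_zero]; omega)
    rw [hg, h0, map_zero, zero_add, map_sum]
    refine OrderGE.sum fun i _ => ?_
    rw [map_mul, add_comm k]
    exact (hG i).mul (ih (hk k hf i))

/-- If F⁻¹(z_i) has constant term r, then F maps F⁻¹(z_i) - r to z_i - r; as F preserves series
without constant term, r = 0. -/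
theorem orderGE_symm_X (F : Series c n R ≃ₐ[R] Series c n R) (hF : ∀ i, OrderGE 1 (F (X i)))
    (i : Fin n) : OrderGE 1 (F.symm (X i)) := by
  have h1 : OrderGE 1 (F.symm (X i) - algebraMap R _ ((F.symm (X i)).coeff 0)) := by
    intro w hw
    obtain rfl := Mon.eq_zero_of_deg c (Nat.lt_one_iff.1 hw)
    rw [coeff_sub, coeff_algebraMap, if_pos rfl, sub_self]
  have h2 := OrderGE.map F.toAlgHom hF h1 0 (by rw [Mon.deg_zero]; omega)
  have h3 : F.toAlgHom (F.symm (X i) - algebraMap R _ ((F.symm (X i)).coeff 0)) =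
      X i - algebraMap R _ ((F.symm (X i)).coeff 0) := by
    rw [map_sub, AlgHom.commutes]
    congr 1
    exact F.apply_symm_apply _
  rw [h3, coeff_sub, coeff_algebraMap, if_pos rfl,
    orderGE_X i 0 (by rw [Mon.deg_zero]; omega), zero_sub, neg_eq_zero] at h2
  rw [h2, map_zero, sub_zero] at h1
  exact h1

end Series

/-! ### The derivations `[u ∂/∂z]` -/

section BracketDer

variable {n : ℕ} {K : Type*} [CommRing K]

theorem Series.mul_comm_commuting (f g : Series .commuting n K) : f * g = g * f :=
  Series.equivMvPowerSeries.injective (by rw [map_mul, map_mul, mul_comm])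

theorem Series.coeff_X_mul_commuting (i : Fin n) (f : Series .commuting n K) (e : Fin n →₀ ℕ) :
    (Series.X i * f).coeff (Mon.ofExp e) =
      if e i = 0 then 0 else f.coeff (Mon.ofExp (e - Finsupp.single i 1)) := by
  split_ifs with h
  · refine Series.coeff_X_mul_of_forall_ne i f _ fun w' hw => ?_
    have := DFunLike.congr_fun (show e = Finsupp.single i 1 + Mon.ofExp.symm w' from hw) i
    rw [Finsupp.add_apply, Finsupp.single_eq_same] at this
    omega
  · rw [← Series.coeff_X_mul_add i f]
    congr 1
    change e = Finsupp.single i 1 + (e - Finsupp.single i 1)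
    exact (add_tsub_cancel_of_le (Finsupp.single_le_iff.2 (Nat.pos_of_ne_zero h))).symm

/-- The partial derivative `∂/∂z_j` in commuting variables. -/
def partialDer (j : Fin n) (f : Series .commuting n K) : Series .commuting n K :=
  ⟨fun w => ((Mon.ofExp.symm w j + 1 : ℕ) : K) *
    f.coeff (Mon.ofExp (Mon.ofExp.symm w + Finsupp.single j 1))⟩

theorem partialDer_X_mul (i j : Fin n) (f : Series .commuting n K) :
    partialDer j (Series.X i * f) = (if i = j then f else 0) + Series.X i * partialDer j f := by
  ext w
  obtain ⟨e, rfl⟩ := Mon.ofExp.surjective w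
  rw [Series.coeff_add, Series.coeff_X_mul_commuting]
  simp only [partialDer, Equiv.symm_apply_apply, Series.coeff_X_mul_commuting]
  by_cases hij : i = j
  · subst hij
    rw [if_pos rfl, if_neg (by simp), add_tsub_cancel_right]
    by_cases h : e i = 0
    · simp [h]
    · rw [if_neg h, tsub_add_cancel_of_le (Finsupp.single_le_iff.2 (Nat.pos_of_ne_zero h)),
        Finsupp.tsub_apply, Finsupp.single_eq_same, Nat.sub_add_cancel (Nat.pos_of_ne_zero h)]
      push_cast
      ring
  · have h1 : (e + Finsupp.single j 1 : Fin n →₀ ℕ) i = e i := by simp [Ne.symm hij]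
    rw [if_neg hij, h1, Series.coeff_zero, zero_add]
    by_cases h : e i = 0
    · simp [h]
    · rw [if_neg h, if_neg h]
      have h2 : e + Finsupp.single j 1 - Finsupp.single i 1 =
          e - Finsupp.single i 1 + Finsupp.single j 1 :=
        tsub_add_eq_add_tsub (Finsupp.single_le_iff.2 (Nat.pos_of_ne_zero h)) |>.symm
      have h3 : (e - Finsupp.single i 1 : Fin n →₀ ℕ) j = e j := by
        simp [hij]
      rw [h2, h3]

/-- The Leibniz rule for a variable on the left. With the vanishing on constants it suffices for all
later uses, by way of `Series.eq_zero_of_map_X_mul`. -/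
theorem bracketDer_X_mul (c : VarKind) (u : Fin n → Series c n K) (i : Fin n)
    (f : Series c n K) :
    bracketDer c u (Series.X i * f) = u i * f + Series.X i * bracketDer c u f := by
  cases c
  · change ∑ j, u j * partialDer j (Series.X i * f) =
      u i * f + Series.X i * ∑ j, u j * partialDer j f
    simp only [partialDer_X_mul, mul_add, Finset.sum_add_distrib, mul_ite, mul_zero,
      Finset.mul_sum]
    rw [Finset.sum_ite_eq Finset.univ i fun j => u j * f, if_pos (Finset.mem_univ i)]
    congr 1
    refine Finset.sum_congr rfl fun j _ => ?_
    rw [← mul_assoc, Series.mul_comm_commuting (u j), mul_assoc]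
  · ext w
    change ∑ j, ∑ p ∈ antidiagonal w, ∑ q ∈ antidiagonal p.2,
      (Series.X i * f).coeff (p.1 + Mon.var .free j + q.2) * (u j).coeff q.1 = _
    -- The empty prefix corresponds to replacing the leading letter z_i and gives u_i f; nonempty
    -- prefixes replace a later letter.
    have h0 : ∀ j, ∑ p ∈ antidiagonal w, ∑ q ∈ antidiagonal p.2,
        (Series.X i * f).coeff (p.1 + Mon.var .free j + q.2) * (u j).coeff q.1 =
        (if j = i then (u i * f).coeff w else 0) +
          ∑ p ∈ (antidiagonal w).erase (0, w), ∑ q ∈ antidiagonal p.2,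
            (Series.X i * f).coeff (p.1 + Mon.var .free j + q.2) * (u j).coeff q.1 := by
      intro j
      rw [← Finset.add_sum_erase _ _ (show (0, w) ∈ antidiagonal w by simp)]
      congr 1
      split_ifs with hj
      · subst hj
        rw [Series.coeff_mul]
        refine Finset.sum_congr rfl fun q _ => ?_
        rw [zero_add, Series.coeff_X_mul_add, mul_comm]
      · refine Finset.sum_eq_zero fun q _ => ?_
        rw [zero_add, Series.coeff_X_mul_of_forall_ne, zero_mul]
        intro w' h
        exact hj (Mon.var_add_inj_free h).1
    simp only [h0]
    rw [Finset.sum_add_distrib, Finset.sum_ite_eq' Finset.univ i, if_pos (Finset.mem_univ i),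
      Series.coeff_add]
    congr 1
    by_cases hw : ∃ w', w = Mon.var .free i + w'
    · obtain ⟨w', rfl⟩ := hw
      rw [Series.coeff_X_mul_add]
      refine Finset.sum_congr rfl fun j _ => ?_
      symm
      refine Finset.sum_of_injOn (fun p => (Mon.var .free i + p.1, p.2)) ?_ ?_ ?_ ?_
      · rintro ⟨a, b⟩ _ ⟨a', b'⟩ _ h
        rw [Prod.mk.injEq] at h
        exact Prod.ext (Mon.var_add_left_cancel .free i h.1) h.2
      · intro p hp
        rw [Finset.mem_coe, mem_antidiagonal] at hp
        rw [Finset.mem_coe, Finset.mem_erase, mem_antidiagonal, add_assoc, hp]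
        exact ⟨fun h => Mon.var_add_ne_zero .free i _ (Prod.mk.inj h).1, rfl⟩
      · rintro ⟨a, b⟩ hp hn
        rw [Finset.mem_erase, mem_antidiagonal] at hp
        refine Finset.sum_eq_zero fun q _ => ?_
        have ha : a ≠ 0 := by
          rintro rfl
          exact hp.1 (by rw [← hp.2, zero_add])
        obtain ⟨k, a', rfl⟩ := Mon.exists_eq_var_add .free a ha
        have h := hp.2
        simp only [add_assoc] at h
        obtain ⟨rfl, h'⟩ := Mon.var_add_inj_free h
        exact absurd ⟨(a', b), Finset.mem_coe.2 (mem_antidiagonal.2 h'), rfl⟩ hn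
      · intro p _
        refine Finset.sum_congr rfl fun q _ => ?_
        simp only [add_assoc, Series.coeff_X_mul_add]
    · rw [Series.coeff_X_mul_of_forall_ne i _ _ (not_exists.1 hw)]
      refine Finset.sum_eq_zero fun j _ => Finset.sum_eq_zero fun p hp =>
        Finset.sum_eq_zero fun q _ => ?_
      obtain ⟨a, b⟩ := p
      rw [Finset.mem_erase, mem_antidiagonal] at hp
      have ha : a ≠ 0 := by
        rintro rfl
        exact hp.1 (by rw [← hp.2, zero_add])
      obtain ⟨k, a', rfl⟩ := Mon.exists_eq_var_add .free a ha
      rw [Series.coeff_X_mul_of_forall_ne, zero_mul]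
      intro w' h
      simp only [add_assoc] at h
      obtain ⟨rfl, -⟩ := Mon.var_add_inj_free h
      exact hw ⟨a' + b, by rw [← hp.2, add_assoc]⟩

theorem bracketDer_algebraMap (c : VarKind) (u : Fin n → Series c n K) (r : K) :
    bracketDer c u (algebraMap K _ r) = 0 := by
  cases c
  · change ∑ j, u j * partialDer j (algebraMap K (Series .commuting n K) r) = 0
    refine Finset.sum_eq_zero fun j _ => ?_
    have : partialDer j (algebraMap K (Series .commuting n K) r) = 0 := by
      ext w
      change _ * _ = (0 : K)
      rw [Series.coeff_algebraMap, if_neg, mul_zero]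
      intro h
      have := DFunLike.congr_fun
        (show Mon.ofExp.symm w + Finsupp.single j 1 = (0 : Fin n →₀ ℕ) from h) j
      simp at this
    rw [this, mul_zero]
  · ext w
    change ∑ j, ∑ p ∈ antidiagonal w, ∑ q ∈ antidiagonal p.2,
      (algebraMap K (Series .free n K) r).coeff (p.1 + Mon.var .free j + q.2) *
        (u j).coeff q.1 = 0
    refine Finset.sum_eq_zero fun j _ => Finset.sum_eq_zero fun p _ =>
      Finset.sum_eq_zero fun q _ => ?_
    rw [Series.coeff_algebraMap, if_neg, zero_mul]
    intro h
    have := congrArg (Mon.deg .free) h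
    rw [Mon.deg_add, Mon.deg_add, Mon.deg_var, Mon.deg_zero] at this
    omega

variable {c : VarKind}

/-- The Leibniz defect, as a function of the left factor, is additive, kills constants and commutes
with left multiplication by each z_i. -/
theorem isDerivation_bracketDer (u : Fin n → Series c n K) : IsDerivation (bracketDer c u) := by
  intro f g
  rw [← sub_eq_zero]
  refine Series.eq_zero_of_map_X_mul
    (fun f => bracketDer c u (f * g) - (bracketDer c u f * g + f * bracketDer c u g)) ?_ ?_
    Series.X Series.orderGE_X ?_ f
  · intro f f'
    simp only [add_mul, map_add]
    abel
  · intro r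
    rw [bracketDer_algebraMap, zero_mul, zero_add, ← Algebra.smul_def, ← Algebra.smul_def,
      map_smul, sub_self]
  · intro i f
    simp only [mul_assoc, bracketDer_X_mul]
    noncomm_ring

/-- Induction on the target order, writing f as a constant plus ∑ z_i g_i: the term u_i g_i gains α
and loses the one degree of z_i, and z_i times the derivative of g_i is covered by induction. -/
theorem raisesDegree_bracketDer {α : ℕ} (hα : 1 ≤ α) {u : Fin n → Series c n K}
    (hu : ∀ i, (u i).OrderGE α) : RaisesDegree α (bracketDer c u) := by
  have key : ∀ j k (f : Series c n K), f.OrderGE k → j ≤ k + (α - 1) →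
      (bracketDer c u f).OrderGE j := by
    intro j
    induction j with
    | zero => exact fun _ _ _ _ => Series.orderGE_zero_left _
    | succ j ih =>
      intro k f hf hj
      obtain ⟨g, hg, hk⟩ := Series.exists_eq_sum_X_mul f
      have hg' : ∀ i, (g i).OrderGE (k - 1) := by
        intro i
        rcases Nat.eq_zero_or_pos k with rfl | h
        · exact Series.orderGE_zero_left _
        · exact hk (k - 1) (by rwa [Nat.sub_add_cancel h]) i
      rw [hg, map_add, bracketDer_algebraMap, zero_add, map_sum]
      refine Series.OrderGE.sum fun i _ => ?_
      rw [bracketDer_X_mul]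
      refine Series.OrderGE.add (((hu i).mul (hg' i)).mono (by omega)) ?_
      rw [add_comm j]
      exact (Series.orderGE_X i).mul (ih (k - 1) (g i) (hg' i) (by omega))
  exact fun k f hf => key _ k f hf le_rfl

end BracketDer

/-! ### The parameter `t` -/

section Parameter

variable {c : VarKind} {n : ℕ} {K : Type*} [CommRing K]

theorem ext_tCoeff {u v : Series c n K⟦X⟧} (h : ∀ m, tCoeff m u = tCoeff m v) : u = v := by
  ext w m
  exact congrArg (fun f => f.coeff w) (h m)

theorem tCoeff_add (m : ℕ) (u v : Series c n K⟦X⟧) :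
    tCoeff m (u + v) = tCoeff m u + tCoeff m v := by
  ext w
  exact map_add _ _ _

theorem tCoeff_sub (m : ℕ) (u v : Series c n K⟦X⟧) :
    tCoeff m (u - v) = tCoeff m u - tCoeff m v := by
  ext w
  exact map_sub _ _ _

theorem tCoeff_mul (m : ℕ) (u v : Series c n K⟦X⟧) :
    tCoeff m (u * v) = ∑ p ∈ antidiagonal m, tCoeff p.1 u * tCoeff p.2 v := by
  ext w
  rw [Series.coeff_sum]
  simp only [tCoeff, Series.coeff_mul, map_sum, PowerSeries.coeff_mul]
  exact Finset.sum_comm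

theorem tCoeff_X (m : ℕ) (i : Fin n) :
    tCoeff m (Series.X i : Series c n K⟦X⟧) = if m = 0 then Series.X i else 0 := by
  ext w
  simp only [tCoeff, Series.X]
  split_ifs <;> simp_all [PowerSeries.coeff_one]

theorem tCoeff_X_mul (m : ℕ) (i : Fin n) (u : Series c n K⟦X⟧) :
    tCoeff m (Series.X i * u) = Series.X i * tCoeff m u := by
  rw [tCoeff_mul, Finset.sum_eq_single (0, m)]
  · rw [tCoeff_X, if_pos rfl]
  · rintro ⟨a, b⟩ hab hne
    rw [mem_antidiagonal] at hab
    have : a ≠ 0 := by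
      rintro rfl
      exact hne (Prod.ext rfl (by simpa using hab))
    rw [tCoeff_X, if_neg this, zero_mul]
  · intro h
    exact absurd (mem_antidiagonal.2 (zero_add m)) h

theorem tCoeff_algebraMap (m : ℕ) (r : K⟦X⟧) :
    tCoeff m (algebraMap K⟦X⟧ (Series c n K⟦X⟧) r) =
      algebraMap K _ (PowerSeries.coeff m r) := by
  ext w
  simp only [tCoeff, Series.coeff_algebraMap]
  split_ifs <;> simp

theorem tCoeff_zero_X_smul (u : Series c n K⟦X⟧) :
    tCoeff 0 ((PowerSeries.X : K⟦X⟧) • u) = 0 := by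
  ext w
  simp [tCoeff]

theorem tCoeff_succ_X_smul (m : ℕ) (u : Series c n K⟦X⟧) :
    tCoeff (m + 1) ((PowerSeries.X : K⟦X⟧) • u) = tCoeff m u := by
  ext w
  simp only [tCoeff, Series.coeff_smul, smul_eq_mul, PowerSeries.coeff_succ_X_mul]

/-- A series independent of `t`. -/
def constT (f : Series c n K) : Series c n K⟦X⟧ := ⟨fun w => PowerSeries.C (f.coeff w)⟩

theorem tCoeff_constT (m : ℕ) (f : Series c n K) :
    tCoeff m (constT f) = if m = 0 then f else 0 := by
  ext w
  simp only [tCoeff, constT, PowerSeries.coeff_C]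
  split_ifs <;> rfl

/-- The splitting u = u_0 + t v drives the induction on powers of t for K[[t]]-linear maps. -/
theorem exists_eq_constT_add (u : Series c n K⟦X⟧) :
    ∃ v : Series c n K⟦X⟧, u = constT (tCoeff 0 u) + (PowerSeries.X : K⟦X⟧) • v ∧
      ∀ m, tCoeff m v = tCoeff (m + 1) u := by
  have hv : ∀ m, tCoeff m (⟨fun w => PowerSeries.mk fun k =>
      PowerSeries.coeff (k + 1) (u.coeff w)⟩ : Series c n K⟦X⟧) = tCoeff (m + 1) u := by
    intro m
    ext w
    simp [tCoeff]
  refine ⟨_, ext_tCoeff fun m => ?_, hv⟩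
  rw [tCoeff_add, tCoeff_constT]
  rcases m with _ | m
  · rw [if_pos rfl, tCoeff_zero_X_smul, add_zero]
  · rw [if_neg m.succ_ne_zero, tCoeff_succ_X_smul, hv, zero_add]

theorem tCoeff_tDeriv (m : ℕ) (u : Series c n K⟦X⟧) :
    tCoeff m (tDeriv u) = (m + 1) • tCoeff (m + 1) u := by
  ext w
  rw [Series.coeff_smul]
  simp only [tCoeff, tDeriv]
  rw [PowerSeries.coeff_derivative, nsmul_eq_mul, mul_comm]
  push_cast
  rfl

theorem tDeriv_add (u v : Series c n K⟦X⟧) : tDeriv (u + v) = tDeriv u + tDeriv v := by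
  ext1
  funext w
  exact map_add _ _ _

theorem tDeriv_mul (u v : Series c n K⟦X⟧) : tDeriv (u * v) = tDeriv u * v + u * tDeriv v := by
  ext1
  funext w
  rw [Series.coeff_add]
  simp only [tDeriv, Series.coeff_mul, map_sum]
  rw [← Finset.sum_add_distrib]
  refine Finset.sum_congr rfl fun p _ => ?_
  rw [Derivation.leibniz, smul_eq_mul, smul_eq_mul, add_comm, mul_comm (v.coeff p.2)]

theorem tDeriv_X (i : Fin n) : tDeriv (Series.X i : Series c n K⟦X⟧) = 0 := by
  refine ext_tCoeff fun m => ?_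
  rw [tCoeff_tDeriv, tCoeff_X, if_neg m.succ_ne_zero, smul_zero]
  rfl

theorem tDeriv_constT (f : Series c n K) : tDeriv (constT f) = 0 := by
  refine ext_tCoeff fun m => ?_
  rw [tCoeff_tDeriv, tCoeff_constT, if_neg m.succ_ne_zero, smul_zero]
  rfl

theorem tDeriv_algebraMap (r : K⟦X⟧) : tDeriv (algebraMap K⟦X⟧ (Series c n K⟦X⟧) r) =
    algebraMap K⟦X⟧ _ (PowerSeries.derivative K r) := by
  ext1
  funext w
  simp only [tDeriv, Series.coeff_algebraMap]
  split_ifs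
  · rfl
  · exact map_zero _

theorem Series.OrderGE.tCoeff {k : ℕ} {u : Series c n K⟦X⟧} (hu : u.OrderGE k) (m : ℕ) :
    (tCoeff m u).OrderGE k := fun w hw => by
  change PowerSeries.coeff m (u.coeff w) = 0
  rw [hu w hw, map_zero]

theorem Series.OrderGE.tDeriv {k : ℕ} {u : Series c n K⟦X⟧} (hu : u.OrderGE k) :
    (tDeriv u).OrderGE k := fun w hw => by
  change PowerSeries.derivative K (u.coeff w) = 0
  rw [hu w hw, map_zero]

theorem tCoeff_act (m : ℕ) (P : (Module.End K (Series c n K))⟦X⟧) (u : Series c n K⟦X⟧) :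
    tCoeff m (act P u) =
      ∑ p ∈ antidiagonal m, (PowerSeries.coeff p.1 P) (tCoeff p.2 u) := by
  ext w
  rw [Series.coeff_sum]
  simp only [tCoeff, act, PowerSeries.coeff_mk]

theorem act_add (P : (Module.End K (Series c n K))⟦X⟧) (u v : Series c n K⟦X⟧) :
    act P (u + v) = act P u + act P v := by
  refine ext_tCoeff fun m => ?_
  simp only [tCoeff_add, tCoeff_act, map_add, Finset.sum_add_distrib]

theorem tCoeff_act_constT (m : ℕ) (P : (Module.End K (Series c n K))⟦X⟧) (f : Series c n K) :
    tCoeff m (act P (constT f)) = PowerSeries.coeff m P f := by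
  rw [tCoeff_act, Finset.sum_eq_single (m, 0)]
  · rw [tCoeff_constT, if_pos rfl]
  · rintro ⟨a, b⟩ hab hne
    rw [mem_antidiagonal] at hab
    have : b ≠ 0 := by
      rintro rfl
      exact hne (Prod.ext (by simpa using hab) rfl)
    rw [tCoeff_constT, if_neg this, map_zero]
  · intro h
    exact absurd (mem_antidiagonal.2 (add_zero m)) h

/-- Series independent of t already detect every coefficient. -/
theorem act_injective {P Q : (Module.End K (Series c n K))⟦X⟧} (h : ∀ u, act P u = act Q u) :
    P = Q := by
  ext1 m
  refine LinearMap.ext fun f => ?_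
  rw [← tCoeff_act_constT, ← tCoeff_act_constT, h]

/-- `[(∑ t^m v_m) ∂/∂z]`. -/
def bracketSeries (v : Fin n → Series c n K⟦X⟧) : (Module.End K (Series c n K))⟦X⟧ :=
  PowerSeries.mk fun m => bracketDer c fun i => tCoeff m (v i)

theorem act_bracketSeries_X_mul (v : Fin n → Series c n K⟦X⟧) (i : Fin n) (u : Series c n K⟦X⟧) :
    act (bracketSeries v) (Series.X i * u) = v i * u + Series.X i * act (bracketSeries v) u := by
  refine ext_tCoeff fun m => ?_
  rw [tCoeff_add, tCoeff_X_mul, tCoeff_act, tCoeff_act, tCoeff_mul, Finset.mul_sum,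
    ← Finset.sum_add_distrib]
  refine Finset.sum_congr rfl fun p _ => ?_
  rw [bracketSeries, PowerSeries.coeff_mk, tCoeff_X_mul, bracketDer_X_mul]

theorem act_bracketSeries_algebraMap (v : Fin n → Series c n K⟦X⟧) (r : K⟦X⟧) :
    act (bracketSeries v) (algebraMap K⟦X⟧ _ r) = 0 := by
  refine ext_tCoeff fun m => ?_
  rw [tCoeff_act, Finset.sum_eq_zero]
  · rfl
  · intro p _
    rw [bracketSeries, PowerSeries.coeff_mk, tCoeff_algebraMap, bracketDer_algebraMap]

/-- The expansion in `t` of the restriction of an endomorphism to series independent of `t`. -/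
def expansion (G : Series c n K⟦X⟧ →ₐ[K⟦X⟧] Series c n K⟦X⟧) :
    (Module.End K (Series c n K))⟦X⟧ :=
  PowerSeries.mk fun m =>
    { toFun := fun f => tCoeff m (G (constT f))
      map_add' := fun f g => by
        have : constT (f + g) = constT f + constT g := by
          ext1
          funext w
          exact map_add PowerSeries.C _ _
        rw [this, map_add, tCoeff_add]
      map_smul' := fun k f => by
        have : constT (k • f) = PowerSeries.C k • constT f := by
          ext1
          funext w
          exact map_mul PowerSeries.C _ _
        rw [this, map_smul, RingHom.id_apply]
        ext w
        simp [tCoeff] }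

variable (G : Series c n K⟦X⟧ →ₐ[K⟦X⟧] Series c n K⟦X⟧)

theorem coeff_expansion (m : ℕ) (f : Series c n K) :
    PowerSeries.coeff m (expansion G) f = tCoeff m (G (constT f)) := by
  rw [expansion, PowerSeries.coeff_mk]
  rfl

/-- K[[t]]-linearity suffices, with no continuity assumption: each coefficient in t is reached after
finitely many splittings u = u_0 + t v. -/
theorem act_expansion (u : Series c n K⟦X⟧) : act (expansion G) u = G u := by
  refine ext_tCoeff fun m => ?_
  induction m generalizing u with
  | zero =>
    obtain ⟨v, hv, -⟩ := exists_eq_constT_add u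
    conv_rhs => rw [hv, map_add, map_smul, tCoeff_add, tCoeff_zero_X_smul, add_zero]
    rw [tCoeff_act]
    simp [coeff_expansion]
  | succ m ih =>
    obtain ⟨v, hv, hv'⟩ := exists_eq_constT_add u
    conv_rhs => rw [hv, map_add, map_smul, tCoeff_add, tCoeff_succ_X_smul, ← ih v]
    rw [tCoeff_act, Finset.Nat.sum_antidiagonal_succ', tCoeff_act, coeff_expansion]
    simp only [hv']

theorem tCoeff_zero_map {u : Series c n K⟦X⟧} (hu : tCoeff 0 u = 0) : tCoeff 0 (G u) = 0 := by
  rw [← act_expansion, tCoeff_act]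
  simp [hu]

end Parameter

/-! ### The operator equation satisfied by the inverse automorphism -/

section Automorphism

variable {c : VarKind} {n : ℕ} {K : Type*} [CommRing K] {α : ℕ}
  {F : Series c n K⟦X⟧ ≃ₐ[K⟦X⟧] Series c n K⟦X⟧}

theorem orderGE_symm_X_of_inAut (hα : 1 ≤ α) (hF : InAut α F) (i : Fin n) :
    (F.symm (Series.X i)).OrderGE 1 := by
  refine Series.orderGE_symm_X F (fun i => ?_) i
  rw [← sub_sub_cancel (Series.X i) (F (Series.X i))]
  exact (Series.orderGE_X i).sub ((hF i).1.mono hα)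

/-- The identity M_t = H_t(G_t) transfers the order condition and the vanishing at t = 0 from H_t to
M_t. -/
theorem inverseDisplacement_eq (F : Series c n K⟦X⟧ ≃ₐ[K⟦X⟧] Series c n K⟦X⟧) (i : Fin n) :
    inverseDisplacement F i = F.symm (Series.X i - F (Series.X i)) := by
  rw [map_sub, F.symm_apply_apply]
  rfl

theorem orderGE_inverseDisplacement (hα : 1 ≤ α) (hF : InAut α F) (i : Fin n) :
    (inverseDisplacement F i).OrderGE α := by
  rw [inverseDisplacement_eq]
  exact Series.OrderGE.map F.symm.toAlgHom (orderGE_symm_X_of_inAut hα hF) (hF i).1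

theorem tCoeff_zero_symm_X (hF : InAut α F) (i : Fin n) :
    tCoeff 0 (F.symm (Series.X i)) = Series.X i := by
  have h : tCoeff 0 (inverseDisplacement F i) = 0 := by
    rw [inverseDisplacement_eq]
    exact tCoeff_zero_map F.symm.toAlgHom (hF i).2
  rw [inverseDisplacement, tCoeff_sub, tCoeff_X, if_pos rfl, sub_eq_zero] at h
  exact h

theorem hSeries_eq (F : Series c n K⟦X⟧ ≃ₐ[K⟦X⟧] Series c n K⟦X⟧) :
    hSeries F = bracketSeries fun i => F (tDeriv (inverseDisplacement F i)) := rfl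

theorem coeff_hSeries_mem (hα : 1 ≤ α) (hF : InAut α F) (m : ℕ) :
    PowerSeries.coeff m (hSeries F) ∈ diffOps c n K α := by
  rw [hSeries, PowerSeries.coeff_mk]
  refine Algebra.subset_adjoin ⟨isDerivation_bracketDer _, raisesDegree_bracketDer hα fun i => ?_⟩
  refine Series.OrderGE.tCoeff (Series.OrderGE.map F.toAlgHom (fun i => ?_)
    (orderGE_inverseDisplacement hα hF i).tDeriv) m
  change (F (Series.X i)).OrderGE 1
  rw [← sub_sub_cancel (Series.X i) (F (Series.X i))]
  exact (Series.orderGE_X i).sub ((hF i).1.mono hα)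

/-- `∂/∂t (u(G_t)) = (∂u/∂t + h(t) u)(G_t)`. -/
theorem tDeriv_symm (hα : 1 ≤ α) (hF : InAut α F) (u : Series c n K⟦X⟧) :
    tDeriv (F.symm u) = F.symm (tDeriv u) + F.symm (act (hSeries F) u) := by
  rw [← sub_eq_zero]
  -- The difference of the two sides kills K[[t]] and turns multiplication by z_i into
  -- multiplication by G_t(z_i): on z_i itself, h(t) was chosen so that both sides give ∂M_t/∂t.
  refine Series.eq_zero_of_map_X_mul
    (fun u => tDeriv (F.symm u) - (F.symm (tDeriv u) + F.symm (act (hSeries F) u))) ?_ ?_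
    (fun i => F.symm (Series.X i)) (orderGE_symm_X_of_inAut hα hF) ?_ u
  · intro u v
    simp only [map_add, tDeriv_add, act_add]
    abel
  · intro r
    rw [hSeries_eq, act_bracketSeries_algebraMap, map_zero, add_zero, tDeriv_algebraMap,
      AlgEquiv.commutes, AlgEquiv.commutes, tDeriv_algebraMap, sub_self]
  · intro i u
    have h : tDeriv (F.symm (Series.X i)) = tDeriv (inverseDisplacement F i) := by
      have : F.symm (Series.X i) = inverseDisplacement F i + Series.X i :=
        (sub_add_cancel _ _).symm
      rw [this, tDeriv_add, tDeriv_X, add_zero]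
    simp only [hSeries_eq, act_bracketSeries_X_mul, map_mul, map_add, tDeriv_mul, tDeriv_X, h,
      F.symm_apply_apply, zero_mul, zero_add]
    noncomm_ring

/-- At t = 0 the automorphism fixes every variable, hence is the identity; the filtration argument
replaces continuity. -/
theorem coeff_zero_expansion (hF : InAut α F) :
    PowerSeries.coeff 0 (expansion F.symm.toAlgHom) = 1 := by
  refine LinearMap.ext fun f => ?_
  rw [coeff_expansion, Module.End.one_apply, ← sub_eq_zero]
  refine Series.eq_zero_of_map_X_mul
    (fun f => tCoeff 0 (F.symm.toAlgHom (constT f)) - f) ?_ ?_ Series.X Series.orderGE_X ?_ f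
  · intro f g
    have := map_add (PowerSeries.coeff 0 (expansion F.symm.toAlgHom)) f g
    simp only [coeff_expansion] at this
    rw [this]
    abel
  · intro r
    have : constT (algebraMap K (Series c n K) r) = algebraMap K⟦X⟧ _ (PowerSeries.C r) := by
      ext1
      funext w
      simp only [constT, Series.coeff_algebraMap]
      split_ifs <;> simp
    rw [this, AlgHom.commutes, tCoeff_algebraMap]
    simp
  · intro i f
    have : constT (Series.X i * f) = Series.X i * constT f := by
      refine ext_tCoeff fun m => ?_
      rw [tCoeff_X_mul, tCoeff_constT, tCoeff_constT]
      split_ifs <;> simp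
    rw [this, map_mul, tCoeff_mul]
    rw [Finset.Nat.antidiagonal_zero, Finset.sum_singleton]
    rw [show tCoeff 0 (F.symm.toAlgHom (Series.X i)) = Series.X i from tCoeff_zero_symm_X hF i,
      mul_sub]

/-- This is E' = E h multiplied by t, obtained from `tDeriv_symm` on series independent of t, where
the term with ∂u/∂t drops out. -/
theorem euler_expansion (hα : 1 ≤ α) (hF : InAut α F) :
    euler (expansion F.symm.toAlgHom) =
      expansion F.symm.toAlgHom * (PowerSeries.X * hSeries F) := by
  ext1 m
  rw [← mul_assoc, ← (PowerSeries.commute_X (expansion F.symm.toAlgHom)).eq.symm, mul_assoc,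
    coeff_euler]
  rcases m with _ | m
  · simp
  · rw [PowerSeries.coeff_succ_X_mul]
    refine LinearMap.ext fun f => ?_
    rw [LinearMap.smul_apply, coeff_expansion, ← tCoeff_tDeriv]
    have h := tDeriv_symm hα hF (constT f)
    rw [tDeriv_constT, map_zero, zero_add] at h
    change tCoeff m (tDeriv (F.symm (constT f))) = _
    rw [h]
    change tCoeff m (F.symm.toAlgHom (act (hSeries F) (constT f))) = _
    rw [← act_expansion, tCoeff_act, PowerSeries.coeff_mul, LinearMap.sum_apply]
    refine Finset.sum_congr rfl fun p _ => ?_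
    rw [tCoeff_act_constT, Module.End.mul_apply]

end Automorphism

end NCSDLog

end

theorem mainTheorem4 {K : Type*} [CommRing K] [Algebra ℚ K] (c : NCSDLog.VarKind) (n α : ℕ)
    (hα : 1 ≤ α)
    (F : NCSDLog.Series c n (PowerSeries K) ≃ₐ[PowerSeries K] NCSDLog.Series c n (PowerSeries K))
    (hF : NCSDLog.InAut α F) :
    (∃! d : PowerSeries (Module.End K (NCSDLog.Series c n K)), NCSDLog.IsDLog α F d) ∧
      ∀ d : PowerSeries (Module.End K (NCSDLog.Series c n K)), NCSDLog.IsDLog α F d →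
        NCSDLog.FormalHasSum
          (fun r : ℕ => NCSDLog.bchTerm K (NCSDLog.hSeries F) (r + 1)) d := by
  obtain ⟨d, hd0, hdE, hdm, hds⟩ := NCSDLog.exists_isExp_bchTerm K (NCSDLog.hSeries F)
    (NCSDLog.expansion F.symm.toAlgHom) (NCSDLog.coeff_zero_expansion hF)
    (NCSDLog.euler_expansion hα hF) (NCSDLog.diffOps c n K α) (NCSDLog.coeff_hSeries_mem hα hF)
  have huniq : ∀ d', NCSDLog.IsDLog α F d' → d' = d := by
    rintro d' ⟨-, h0, E, hE, hact⟩
    -- Any exponential acting as u ↦ u(G_t) is the expansion of F⁻¹, so all candidates share one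
    -- exponential.
    obtain rfl : E = NCSDLog.expansion F.symm.toAlgHom := NCSDLog.act_injective fun u =>
      (hact u).trans (NCSDLog.act_expansion F.symm.toAlgHom u).symm
    exact NCSDLog.IsExp.unique K h0 hd0 hE hdE
  refine ⟨⟨d, ⟨hdm, hd0, _, hdE, fun u => NCSDLog.act_expansion F.symm.toAlgHom u⟩, huniq⟩, ?_⟩
  intro d' hd'
  rw [huniq d' hd']
  exact hds
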